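/- Let $S^2$ be the unit sphere in $\mathbb{R}^3$, let $F_n(S^2)=\{(x_1,\dots,x_n)\in (S^2)^n : x_i\neq x_j \text{ for } i\neq j\}$ be its $n$th ordered configuration space, and let $\iota_n\colon F_n(S^2)\to \prod_1^n S^2$ be the inclusion, with induced homomorphism $(\iota_n)_{\#k}\colon \pi_k(F_n(S^2))\to\pi_k\bigl(\prod_1^n S^2\bigr)$, for an arbitrary base point $w=(w_1,\dots,w_n)\in F_n(S^2)$. Identify $\pi_k\bigl(\prod_1^n S^2,w\bigr)$ with $\prod_{i=1}^n\pi_k(S^2,w_i)$ by means of the projections, and each $\pi_k(S^2,w_i)$ with $\pi_k(S^2,x_0)$, where $x_0\in S^2$ is a fixed point, by change of base point along any path from $w_i$ to $x_0$. Thus $(\iota_n)_{\#k}$ becomes a homomorphism $\pi_k(F_n(S^2),w)\to \pi_k(S^2,x_0)^n$. The following hold for every choice of $w$, $x_0$ and of the paths. (a) If $n=k=2$, the groups $\pi_2(F_2(S^2))$ and $\pi_2(S^2)$ are infinite cyclic, and $(\iota_2)_{\#2}$ is anti-diagonal, that is, its second component is the negative of its first component. Moreover, for every isomorphism $\pi_2(S^2,x_0)\cong\mathbb{Z}$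 (orientation of $S^2$) and every generator $g$ of $\pi_2(F_2(S^2),w)$, $(\iota_2)_{\#2}(g)$ is equal to $(1,-1)$ or to $(-1,1)$ in $\mathbb{Z}\times\mathbb{Z}$. (b) If $n\geq 2$ and $k\geq 3$, then $(\iota_n)_{\#k}$ is diagonal, that is, its $n$ components $\pi_k(F_n(S^2),w)\to\pi_k(S^2,x_0)$ coincide. -/

import Mathlib

open scoped unitInterval Topology Topology.Homotopy

set_option linter.unusedSectionVars false

noncomputable section

namespace HomotopyGroup

/-! ### Induced homomorphisms -/

section Map

variable {N X Y : Type*} [TopologicalSpace X] [TopologicalSpace Y]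

/-- Composition of a generalized loop with a continuous map. -/
def genLoopMap (f : C(X, Y)) {x : X} (p : Ω^ N X x) : Ω^ N Y (f x) :=
  ⟨f.comp p.1, fun y hy => congrArg f (p.2 y hy)⟩

/-- The class of a generalized loop in the homotopy group. -/
def mk {x : X} (p : Ω^ N X x) : HomotopyGroup N X x := Quotient.mk _ p

theorem mk_mul_mk [DecidableEq N] [Nonempty N] {x : X} (i : N) (p q : Ω^ N X x) :
    mk p * mk q = mk (GenLoop.transAt i q p) := mul_spec

theorem mk_eq_mk {x : X} {p q : Ω^ N X x} (h : GenLoop.Homotopic p q) : mk p = mk q :=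
  Quotient.sound h

/-- The map `f_# : π_N(X, x) → π_N(Y, f x)` induced by a continuous map `f`. -/
def mapFun (f : C(X, Y)) (x : X) : HomotopyGroup N X x → HomotopyGroup N Y (f x) :=
  Quotient.map (genLoopMap f) fun _ _ h => h.comp_continuousMap f

/-- The homomorphism `f_# : π_N(X, x) → π_N(Y, f x)` induced by a continuous map `f`. -/
def map [DecidableEq N] [Nonempty N] (f : C(X, Y)) (x : X) :
    HomotopyGroup N X x →* HomotopyGroup N Y (f x) :=
  MonoidHom.mk' (mapFun f x) (by
    rintro ⟨p⟩ ⟨q⟩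
    let i : N := Classical.arbitrary N
    change mapFun f x (mk p * mk q) = mk (genLoopMap f p) * mk (genLoopMap f q)
    rw [mk_mul_mk i, mk_mul_mk i]
    change mk (genLoopMap f (GenLoop.transAt i q p)) = _
    congr 1
    ext y
    change f (ite _ _ _) = ite _ _ _
    split_ifs <;> rfl)

end Map

/-! ### Homotopy groups of a product -/

section Pi

variable {N ι : Type*} {X : ι → Type*} [∀ i, TopologicalSpace (X i)] [DecidableEq N] [Nonempty N]

/-- The `i`-th projection as a continuous map. -/
def proj (i : ι) : C(∀ i, X i, X i) := ⟨fun x => x i, continuous_apply i⟩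

/-- The homomorphism from the homotopy group of a product to the product of the homotopy groups
whose components are induced by the projections. -/
def piHom (x : ∀ i, X i) :
    HomotopyGroup N (∀ i, X i) x →* ∀ i, HomotopyGroup N (X i) (x i) :=
  MonoidHom.mk' (fun a i => map (proj i) x a) (fun a b => funext fun _ => map_mul _ a b)

theorem piHom_bijective (x : ∀ i, X i) : Function.Bijective (piHom (N := N) x) := by
  constructor
  · rintro ⟨p⟩ ⟨q⟩ h
    have h' : ∀ i, (genLoopMap (proj i) p).1.HomotopicRel (genLoopMap (proj i) q).1
        (Cube.boundary N) := fun i => Quotient.exact (congrFun h i)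
    refine Quotient.sound ⟨⟨⟨⟨fun z i => (h' i).some z, by fun_prop⟩, ?_, ?_⟩, ?_⟩⟩
    · intro y; funext i; exact (h' i).some.apply_zero y
    · intro y; funext i; exact (h' i).some.apply_one y
    · intro t y hy; funext i; exact (h' i).some.eq_fst t hy
  · intro b
    refine ⟨⟦⟨⟨fun y i => (b i).out y, by fun_prop⟩, fun y hy => funext fun i =>
      (b i).out.2 y hy⟩⟧, ?_⟩
    exact funext fun i => (b i).out_eq

/-- `π_N(∏ X i) ≅ ∏ π_N(X i)`, the isomorphism whose components are induced by the projections. -/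
def piEquiv (x : ∀ i, X i) :
    HomotopyGroup N (∀ i, X i) x ≃* ∀ i, HomotopyGroup N (X i) (x i) :=
  MulEquiv.ofBijective (piHom x) (piHom_bijective x)

end Pi

/-! ### Change of base point along a path -/

section Transport

/-- Twice the sup-norm distance from a point of the cube to the centre. -/
def cubeRadius {N : Type*} [Fintype N] (y : I^N) : ℝ := ‖fun i => 2 * (y i : ℝ) - 1‖

/-- Dilation of the cube about its centre by the factor `r`, followed by the coordinatewise
retraction onto the cube. -/
def cubeDilate {N : Type*} (r : ℝ) (y : I^N) : I^N :=
  fun i => Set.projIcc (0 : ℝ) 1 zero_le_one (r * ((y i : ℝ) - 1 / 2) + 1 / 2)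

variable {N X : Type*} [Fintype N] [Nonempty N] [TopologicalSpace X]

theorem continuous_cubeRadius : Continuous (cubeRadius (N := N)) := by
  unfold cubeRadius; fun_prop

theorem continuous_cubeDilate {Z : Type*} [TopologicalSpace Z] {r : Z → ℝ} {y : Z → I^N}
    (hr : Continuous r) (hy : Continuous y) : Continuous fun z => cubeDilate (r z) (y z) := by
  unfold cubeDilate
  refine continuous_pi fun i => continuous_projIcc.comp ?_
  fun_prop

theorem cubeRadius_of_boundary {y : I^N} (hy : y ∈ Cube.boundary N) : cubeRadius y = 1 := by
  apply le_antisymm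
  · refine (pi_norm_le_iff_of_nonneg zero_le_one).2 fun i => ?_
    rw [Real.norm_eq_abs, abs_le]
    constructor <;> linarith [(y i).2.1, (y i).2.2]
  · obtain ⟨i, hi⟩ := hy
    refine le_trans ?_ (norm_le_pi_norm (fun i => 2 * (y i : ℝ) - 1) i)
    rcases hi with hi | hi <;> norm_num [hi]

theorem cubeRadius_le_one (y : I^N) : cubeRadius y ≤ 1 := by
  refine (pi_norm_le_iff_of_nonneg zero_le_one).2 fun i => ?_
  rw [Real.norm_eq_abs, abs_le]
  constructor <;> linarith [(y i).2.1, (y i).2.2]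

theorem cubeDilate_one (y : I^N) : cubeDilate 1 y = y := by
  funext i
  have : (1 : ℝ) * ((y i : ℝ) - 1 / 2) + 1 / 2 = y i := by ring
  simp only [cubeDilate, this, Set.projIcc_val]

theorem cubeDilate_mem_boundary {r : ℝ} {y : I^N} (h : 1 ≤ r * cubeRadius y) (hr : 0 ≤ r) :
    cubeDilate r y ∈ Cube.boundary N := by
  obtain ⟨i, -, hi⟩ := Finset.exists_max_image Finset.univ (fun i : N => |2 * (y i : ℝ) - 1|)
    Finset.univ_nonempty
  have hn : cubeRadius y ≤ |2 * (y i : ℝ) - 1| :=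
    (pi_norm_le_iff_of_nonneg (abs_nonneg _)).2 fun j => hi j (Finset.mem_univ j)
  have h1 : 1 ≤ r * |2 * (y i : ℝ) - 1| := h.trans (mul_le_mul_of_nonneg_left hn hr)
  refine ⟨i, ?_⟩
  rcases abs_cases (2 * (y i : ℝ) - 1) with ⟨h2, -⟩ | ⟨h2, -⟩ <;> rw [h2] at h1
  · right; exact Set.projIcc_of_right_le _ (by nlinarith)
  · left; exact Set.projIcc_of_le_left _ (by nlinarith)

/-- A family of maps `F z` on the cube, shrunk by the factor `r z` to a smaller concentric cube,
and extended over the remaining shell radially by the path `G z`. -/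
def extendCube {Z : Type*} [TopologicalSpace Z] (r : C(Z, ℝ)) (F : C(Z × (I^N), X))
    (G : C(Z × I, X)) (p : Z × (I^N)) : X :=
  if r p.1 * cubeRadius p.2 ≤ 1 then F (p.1, cubeDilate (r p.1) p.2)
  else G (p.1, Set.projIcc (0 : ℝ) 1 zero_le_one (r p.1 * cubeRadius p.2 - 1))

theorem continuous_extendCube {Z : Type*} [TopologicalSpace Z] (r : C(Z, ℝ))
    (F : C(Z × (I^N), X)) (G : C(Z × I, X)) (hr : ∀ z, 1 ≤ r z)
    (hFG : ∀ z, ∀ y ∈ Cube.boundary N, F (z, y) = G (z, 0)) :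
    Continuous (extendCube r F G) := by
  have hm : Continuous fun p : Z × (I^N) => r p.1 * cubeRadius p.2 :=
    (r.continuous.comp continuous_fst).mul (continuous_cubeRadius.comp continuous_snd)
  refine Continuous.if_le ?_ ?_ hm continuous_const ?_
  · exact F.continuous.comp (continuous_fst.prodMk
      (continuous_cubeDilate (r.continuous.comp continuous_fst) continuous_snd))
  · exact G.continuous.comp (continuous_fst.prodMk
      ((continuous_projIcc (h := zero_le_one)).comp (hm.sub continuous_const)))
  · intro p hp
    rw [hFG _ _ (cubeDilate_mem_boundary hp.ge (by linarith [hr p.1])), hp, sub_self,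
      Set.projIcc_left]
    rfl

theorem extendCube_of_boundary {Z : Type*} [TopologicalSpace Z] (r : C(Z, ℝ))
    (F : C(Z × (I^N), X)) (G : C(Z × I, X)) (hr : ∀ z, 1 ≤ r z)
    (hFG : ∀ z, ∀ y ∈ Cube.boundary N, F (z, y) = G (z, 0)) (z : Z) {y : I^N}
    (hy : y ∈ Cube.boundary N) :
    extendCube r F G (z, y) = G (z, Set.projIcc (0 : ℝ) 1 zero_le_one (r z - 1)) := by
  unfold extendCube
  have h1 := cubeRadius_of_boundary hy
  simp only [h1, mul_one]
  split_ifs with h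
  · have hz : r z = 1 := le_antisymm h (hr z)
    rw [hFG _ _ (cubeDilate_mem_boundary (by rw [h1, hz]; norm_num) (by linarith)), hz, sub_self,
      Set.projIcc_left]
    rfl
  · rfl

variable {x y : X}

/-- The change of base point of a generalized loop `f` along a path `γ`, as a map on the cube:
the loop `f` is shrunk to the concentric cube of half the size, and every radial segment of the
shell follows `γ`. -/
def transportMap (γ : Path x y) (f : Ω^ N X x) (z : I^N) : X :=
  if 2 * cubeRadius z ≤ 1 then f (cubeDilate 2 z)
  else γ (Set.projIcc (0 : ℝ) 1 zero_le_one (2 * cubeRadius z - 1))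

theorem continuous_transportMap (γ : Path x y) (f : Ω^ N X x) :
    Continuous (transportMap γ f) := by
  let r : C(Unit, ℝ) := .const _ 2
  let F : C(Unit × (I^N), X) := f.1.comp .snd
  let G : C(Unit × I, X) := γ.toContinuousMap.comp .snd
  have h : Continuous (extendCube r F G) := continuous_extendCube r F G
    (fun _ => by norm_num [r]) (fun _ y hy => (f.2 y hy).trans γ.source.symm)
  have h' : transportMap γ f = fun z => extendCube r F G ((), z) := rfl
  rw [h']
  fun_prop

theorem transportMap_of_boundary (γ : Path x y) (f : Ω^ N X x) {z : I^N}
    (hz : z ∈ Cube.boundary N) : transportMap γ f z = y := by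
  norm_num [transportMap, cubeRadius_of_boundary hz]

/-- The change of base point of a generalized loop along a path, as a generalized loop. -/
def genLoopTransport (γ : Path x y) (f : Ω^ N X x) : Ω^ N X y :=
  ⟨⟨transportMap γ f, continuous_transportMap γ f⟩, fun _ hz => transportMap_of_boundary γ f hz⟩

/-- `f` and `g` are freely homotopic, the image of the boundary tracing out the path `γ`. -/
def HomotopicAlong (γ : Path x y) (f : Ω^ N X x) (g : Ω^ N X y) : Prop :=
  ∃ H : C(I × (I^N), X), (∀ z, H (0, z) = f z) ∧ (∀ z, H (1, z) = g z) ∧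
    ∀ t, ∀ z ∈ Cube.boundary N, H (t, z) = γ t

theorem homotopicAlong_transport (γ : Path x y) (f : Ω^ N X x) :
    HomotopicAlong γ f (genLoopTransport γ f) := by
  let r : C(I, ℝ) := ⟨fun s => 1 + (s : ℝ), by fun_prop⟩
  let F : C(I × (I^N), X) := f.1.comp .snd
  let G : C(I × I, X) := γ.toContinuousMap.comp .snd
  have hr : ∀ s, 1 ≤ r s := fun s => by
    change (1 : ℝ) ≤ 1 + s
    linarith [s.2.1]
  have hFG : ∀ s, ∀ z ∈ Cube.boundary N, F (s, z) = G (s, 0) := fun s z hz =>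
    (f.2 z hz).trans γ.source.symm
  refine ⟨⟨extendCube r F G, continuous_extendCube r F G hr hFG⟩, ?_, ?_, ?_⟩
  · intro z
    have := cubeRadius_le_one z
    change extendCube r F G (0, z) = f z
    have h0 : r 0 = 1 := by simp [r]
    simp only [extendCube, h0, one_mul, this, if_true, cubeDilate_one]
    rfl
  · intro z
    change extendCube r F G (1, z) = transportMap γ f z
    have h1 : r 1 = 2 := by norm_num [r]
    simp only [extendCube, transportMap, h1]
    rfl
  · intro t z hz
    refine (extendCube_of_boundary r F G hr hFG t hz).trans ?_
    simp [r, G]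

theorem transport_refl_homotopic (f : Ω^ N X x) :
    GenLoop.Homotopic (genLoopTransport (Path.refl x) f) f := by
  obtain ⟨H, h0, h1, hb⟩ := homotopicAlong_transport (Path.refl x) f
  symm
  exact ⟨⟨⟨H, h0, h1⟩, fun t z hz => (hb t z hz).trans (f.2 z hz).symm⟩⟩

theorem HomotopicAlong.transport_homotopic {γ : Path x y} {f : Ω^ N X x} {g : Ω^ N X y}
    (h : HomotopicAlong γ f g) : GenLoop.Homotopic (genLoopTransport γ f) g := by
  obtain ⟨H, h0, h1, hb⟩ := h
  refine GenLoop.Homotopic.trans ?_ (transport_refl_homotopic g)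
  let r : C(I, ℝ) := .const _ 2
  let G : C(I × I, X) := ⟨fun p => γ (σ (σ p.1 * σ p.2)), by fun_prop⟩
  have hr : ∀ s, 1 ≤ r s := fun s => by norm_num [r]
  have hFG : ∀ s, ∀ z ∈ Cube.boundary N, H (s, z) = G (s, 0) := fun s z hz => by
    simp [G, hb s z hz]
  refine ⟨⟨⟨⟨extendCube r H G, continuous_extendCube r H G hr hFG⟩, ?_, ?_⟩, ?_⟩⟩
  · intro z
    change extendCube r H G (0, z) = transportMap γ f z
    simp [extendCube, transportMap, h0, G, r]
  · intro z
    change extendCube r H G (1, z) = transportMap (Path.refl y) g z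
    simp [extendCube, transportMap, h1, G, r]
  · intro t z hz
    refine (extendCube_of_boundary r H G hr hFG t hz).trans
      (Eq.trans ?_ (transportMap_of_boundary γ f hz).symm)
    norm_num [G, r]

theorem transport_congr {γ : Path x y} {f f' : Ω^ N X x} (h : GenLoop.Homotopic f f') :
    GenLoop.Homotopic (genLoopTransport γ f) (genLoopTransport γ f') := by
  obtain ⟨H⟩ := h
  let r : C(I, ℝ) := .const _ 2
  let G : C(I × I, X) := γ.toContinuousMap.comp .snd
  have hr : ∀ s, 1 ≤ r s := fun s => by norm_num [r]
  have hFG : ∀ s, ∀ z ∈ Cube.boundary N, H.toContinuousMap (s, z) = G (s, 0) := fun s z hz =>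
    ((H.eq_fst s hz).trans (f.2 z hz)).trans γ.source.symm
  refine ⟨⟨⟨⟨extendCube r H.toContinuousMap G,
    continuous_extendCube r H.toContinuousMap G hr hFG⟩, ?_, ?_⟩, ?_⟩⟩
  · intro z
    change extendCube r H.toContinuousMap G (0, z) = transportMap γ f z
    exact congrArg (fun c => ite (2 * cubeRadius z ≤ 1) c _) (H.apply_zero _)
  · intro z
    change extendCube r H.toContinuousMap G (1, z) = transportMap γ f' z
    exact congrArg (fun c => ite (2 * cubeRadius z ≤ 1) c _) (H.apply_one _)
  · intro t z hz
    refine (extendCube_of_boundary r H.toContinuousMap G hr hFG t hz).trans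
      (Eq.trans ?_ (transportMap_of_boundary γ f hz).symm)
    norm_num [G, r]

theorem HomotopicAlong.symm {γ : Path x y} {f : Ω^ N X x} {g : Ω^ N X y}
    (h : HomotopicAlong γ f g) : HomotopicAlong γ.symm g f := by
  obtain ⟨H, h0, h1, hb⟩ := h
  refine ⟨⟨fun p => H (σ p.1, p.2), by fun_prop⟩, ?_, ?_, ?_⟩
  · intro z; simp [h1]
  · intro z; simp [h0]
  · intro t z hz; exact hb _ z hz

theorem HomotopicAlong.transAt [DecidableEq N] {γ : Path x y} {f f' : Ω^ N X x} {g g' : Ω^ N X y}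
    (h : HomotopicAlong γ f g) (h' : HomotopicAlong γ f' g') (i : N) :
    HomotopicAlong γ (GenLoop.transAt i f f') (GenLoop.transAt i g g') := by
  obtain ⟨H, h0, h1, hb⟩ := h
  obtain ⟨H', h0', h1', hb'⟩ := h'
  refine ⟨⟨fun p => if (p.2 i : ℝ) ≤ 1 / 2
      then H (p.1, Function.update p.2 i <| Set.projIcc 0 1 zero_le_one (2 * (p.2 i : ℝ)))
      else H' (p.1, Function.update p.2 i <| Set.projIcc 0 1 zero_le_one (2 * (p.2 i : ℝ) - 1)),
      ?_⟩, ?_, ?_, ?_⟩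
  · have hu : ∀ c : ℝ, Continuous fun p : I × (I^N) =>
        ((p.1, Function.update p.2 i
          (Set.projIcc (0 : ℝ) 1 zero_le_one (2 * (p.2 i : ℝ) - c))) : I × (I^N)) := fun c =>
      continuous_fst.prodMk (continuous_snd.update i (continuous_projIcc.comp (by fun_prop)))
    refine Continuous.if_le (H.continuous.comp (by simpa using hu 0))
      (H'.continuous.comp (hu 1)) (by fun_prop) continuous_const ?_
    intro p hp
    rw [hb _ _ ⟨i, Or.inr ?_⟩, hb' _ _ ⟨i, Or.inl ?_⟩]
    · rw [Function.update_self, hp]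
      exact Set.projIcc_of_le_left _ (by norm_num)
    · rw [Function.update_self, hp]
      exact Set.projIcc_of_right_le _ (by norm_num)
  · intro z
    change ite _ _ _ = ite _ _ _
    simp only [h0, h0']
  · intro z
    change ite _ _ _ = ite _ _ _
    simp only [h1, h1']
  · intro t z hz
    obtain ⟨j, hj⟩ := hz
    change ite _ _ _ = _
    by_cases hji : j = i
    · subst hji
      rcases hj with hj | hj
      · rw [if_pos (by simp [hj])]
        exact hb _ _ ⟨j, Or.inl (by simp [hj])⟩
      · rw [if_neg (by norm_num [hj])]
        refine hb' _ _ ⟨j, Or.inr ?_⟩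
        simp only [Function.update_self, hj]
        exact Set.projIcc_of_right_le _ (by norm_num)
    · split_ifs
      · exact hb _ _ ⟨j, by simpa [Function.update_of_ne hji] using hj⟩
      · exact hb' _ _ ⟨j, by simpa [Function.update_of_ne hji] using hj⟩

/-- The change of base point map `π_N(X, x) → π_N(X, y)` along a path `γ` from `x` to `y`. -/
def transportFun (γ : Path x y) : HomotopyGroup N X x → HomotopyGroup N X y :=
  Quotient.map (genLoopTransport γ) fun _ _ h => transport_congr h

theorem transportFun_symm (γ : Path x y) (a : HomotopyGroup N X x) :
    transportFun γ.symm (transportFun γ a) = a := by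
  obtain ⟨f⟩ := a
  exact mk_eq_mk (homotopicAlong_transport γ f).symm.transport_homotopic

/-- The change of base point isomorphism `π_N(X, x) ≅ π_N(X, y)` along a path `γ`. -/
def transport [DecidableEq N] (γ : Path x y) : HomotopyGroup N X x ≃* HomotopyGroup N X y where
  toFun := transportFun γ
  invFun := transportFun γ.symm
  left_inv := transportFun_symm γ
  right_inv a := by simpa using transportFun_symm γ.symm a
  map_mul' := by
    rintro ⟨f⟩ ⟨g⟩
    let i : N := Classical.arbitrary N
    change transportFun γ (mk f * mk g) = mk (genLoopTransport γ f) * mk (genLoopTransport γ g)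
    rw [mk_mul_mk i, mk_mul_mk i]
    exact mk_eq_mk ((homotopicAlong_transport γ g).transAt
      (homotopicAlong_transport γ f) i).transport_homotopic

end Transport

end HomotopyGroup

/-! ### Configuration spaces -/

/-- The `2`-sphere: the unit sphere of Euclidean `3`-space. -/
abbrev TwoSphere : Type := Metric.sphere (0 : EuclideanSpace ℝ (Fin 3)) 1

/-- The `n`-th (ordered) configuration space of `X`, a subspace of the `n`-fold product of `X`. -/
abbrev ConfigurationSpace (n : ℕ) (X : Type*) : Type _ :=
  {x : Fin n → X // ∀ i j, i ≠ j → x i ≠ x j}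

/-- The inclusion `ι_n` of the `n`-th configuration space of `X` in the `n`-fold product of `X`. -/
def configurationInclusion (n : ℕ) (X : Type*) [TopologicalSpace X] :
    C(ConfigurationSpace n X, Fin n → X) :=
  ⟨Subtype.val, continuous_subtype_val⟩

/-- The homomorphism `(ι_n)_{#k} : π_k(F_n(X), w) → π_k(∏ X, w) ≅ ∏ π_k(X, w i) ≅ ∏ π_k(X, x₀)`,
where the first isomorphism is given by the projections, and the second one by change of base
points along paths `γ i` from `w i` to `x₀`. -/
def iotaHom {n : ℕ} (k : ℕ) [NeZero k] {X : Type*} [TopologicalSpace X]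
    (w : ConfigurationSpace n X) {x₀ : X} (γ : ∀ i, Path (configurationInclusion n X w i) x₀) :
    π_ k (ConfigurationSpace n X) w →* (Fin n → π_ k X x₀) :=
  (MulEquiv.piCongrRight fun i => HomotopyGroup.transport (γ i)).toMonoidHom.comp
    ((HomotopyGroup.piEquiv (configurationInclusion n X w)).toMonoidHom.comp
      (HomotopyGroup.map (configurationInclusion n X) w))

/-- A homomorphism to a power of a group is diagonal if all its components coincide. -/
def IsDiagonalHom {A B ι : Type*} [Group A] [Group B] (f : A →* (ι → B)) : Prop :=
  ∀ a i j, f a i = f a j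

/-- A homomorphism to the square of a group is anti-diagonal if its components are inverse to each
other. -/
def IsAntiDiagonalHom {A B : Type*} [Group A] [Group B] (f : A →* (Fin 2 → B)) : Prop :=
  ∀ a, f a 1 = (f a 0)⁻¹

end

/-!
The proof rests on the Hopf map `hopf : S³ → S²`, where `S³` is the group of unit quaternions
acting on `S²` by conjugation, and on two facts about the antipodal map `a` of `S²`. It is covered
by the right multiplication by `j`, that is `hopf (u * j) = -hopf u`, and this multiplication
reverses the Hopf circles: `z * j = j * z⁻¹` for `z` in the circle `ofCircle`.

Lifting along the Hopf map is done by parallel transport (`exists_parallelTransport`): any family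
of paths on `S²` is carried by a continuous family of rotations that depends only on the path, so
that constant paths are not moved.

In dimension two, the lift of a loop of `S²` is constant on three sides of the square and winds
around a Hopf circle on the fourth one. The winding number is the degree of the loop. It is
invariant under free homotopies, additive, and takes all values; it determines the loop up to
homotopy because `π₂(S³) = 0` (`genLoop_sphere_null`, by a smooth approximation that misses a
point). Hence `π₂(S²) ≅ ℤ`, and `a` changes the sign of the degree because it reverses the Hopf
circles.

In dimension at least three, the boundary map into a Hopf circle is null, so that the loop lifts
to a loop `φ` of `S³`. The homotopy class of `φ` up to conjugation determines the free homotopy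
class of the loop, with any change of base point, and conjugation acts trivially because `S³` is
connected. The loop composed with `a` lifts to `j⁻¹ * φ * j`, so that it is freely homotopic to
the loop itself.

Finally, for two distinct points `x` and `y` of the sphere, `y` can be moved to `-x` in the
complement of `x` along the radial projection of the segment from `y` to `-x`. So any component of
a loop of configurations is freely homotopic to the antipode of any other component, and the
configuration space of two points deforms to the sphere of pairs `(x, -x)`.
-/

noncomputable section

open scoped Quaternion

/-! ### Unit quaternions acting on the sphere -/

/-- The group `S³` of unit quaternions. -/
abbrev UnitQuaternion : Type := Metric.sphere (0 : ℍ[ℝ]) 1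

namespace UnitQuaternion

/-- The quaternion with given coordinates. -/
def quat (a b c d : ℝ) : ℍ[ℝ] := ⟨a, b, c, d⟩

section
variable (a b c d : ℝ)
@[simp] theorem re_quat : (quat a b c d).re = a := rfl
@[simp] theorem imI_quat : (quat a b c d).imI = b := rfl
@[simp] theorem imJ_quat : (quat a b c d).imJ = c := rfl
@[simp] theorem imK_quat : (quat a b c d).imK = d := rfl
end

end UnitQuaternion

namespace TwoSphere

open UnitQuaternion

/-- A point of the sphere as a purely imaginary quaternion. -/
def toQuaternion (x : TwoSphere) : ℍ[ℝ] := quat 0 (x.1 0) (x.1 1) (x.1 2)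

theorem sum_sq (x : TwoSphere) : x.1 0 ^ 2 + x.1 1 ^ 2 + x.1 2 ^ 2 = 1 := by
  have h : ‖x.1‖ = 1 := by simp
  have h2 := EuclideanSpace.norm_sq_eq x.1
  rw [h, Fin.sum_univ_three] at h2
  simpa using h2.symm

/-- The point of the sphere with given coordinates. -/
def ofCoords (a b c : ℝ) (h : a ^ 2 + b ^ 2 + c ^ 2 = 1) : TwoSphere :=
  ⟨!₂[a, b, c], by
    rw [mem_sphere_zero_iff_norm, EuclideanSpace.norm_eq, Fin.sum_univ_three]
    simp [h]⟩

theorem toQuaternion_injective : Function.Injective toQuaternion := by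
  intro x y h
  ext i
  fin_cases i
  exacts [congrArg QuaternionAlgebra.imI h, congrArg QuaternionAlgebra.imJ h,
    congrArg QuaternionAlgebra.imK h]

theorem continuous_toQuaternion : Continuous toQuaternion := by
  have h : Continuous fun x : TwoSphere =>
      Quaternion.linearIsometryEquivTuple.symm (!₂[0, x.1 0, x.1 1, x.1 2]) := by
    refine Quaternion.linearIsometryEquivTuple.symm.continuous.comp ?_
    refine (PiLp.continuous_toLp 2 _).comp (continuous_pi fun i => ?_)
    fin_cases i <;> simp <;> fun_prop
  exact h

theorem normSq_toQuaternion (x : TwoSphere) : Quaternion.normSq (toQuaternion x) = 1 := by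
  rw [Quaternion.normSq_def']
  simp [toQuaternion, sum_sq]

theorem toQuaternion_neg (x : TwoSphere) : toQuaternion (-x) = -toQuaternion x := by
  ext <;> simp [toQuaternion]

theorem ne_neg_self (x : TwoSphere) : x ≠ -x := by
  intro h
  have h1 : x.1 = -x.1 := congrArg Subtype.val h
  have h2 : (2 : ℝ) • x.1 = 0 := by rw [two_smul]; nth_rw 1 [h1]; exact neg_add_cancel _
  exact Metric.ne_of_mem_sphere x.2 one_ne_zero ((smul_eq_zero.1 h2).resolve_left two_ne_zero)

end TwoSphere

namespace UnitQuaternion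

open TwoSphere

theorem normSq_coe (u : UnitQuaternion) : Quaternion.normSq (u : ℍ[ℝ]) = 1 := by
  rw [Quaternion.normSq_eq_norm_mul_self]; simp

theorem coe_inv_eq_star (u : UnitQuaternion) :
    ((u⁻¹ : UnitQuaternion) : ℍ[ℝ]) = star (u : ℍ[ℝ]) := by
  rw [Metric.unitSphere.coe_inv, Quaternion.inv_def, normSq_coe]; simp

theorem conj_re (u x : ℍ[ℝ]) (hx : x.re = 0) : (u * x * star u).re = 0 := by
  simp [hx]; ring

/-- The rotation of the sphere given by conjugation by a unit quaternion. -/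
def rot (u : UnitQuaternion) (x : TwoSphere) : TwoSphere :=
  ofCoords ((u : ℍ[ℝ]) * toQuaternion x * star (u : ℍ[ℝ])).imI
    ((u : ℍ[ℝ]) * toQuaternion x * star (u : ℍ[ℝ])).imJ
    ((u : ℍ[ℝ]) * toQuaternion x * star (u : ℍ[ℝ])).imK (by
      have h := Quaternion.normSq_def' ((u : ℍ[ℝ]) * toQuaternion x * star (u : ℍ[ℝ]))
      rw [map_mul, map_mul, Quaternion.normSq_star, normSq_coe, normSq_toQuaternion,
        conj_re _ _ rfl] at h
      linarith)

theorem toQuaternion_rot (u : UnitQuaternion) (x : TwoSphere) :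
    toQuaternion (rot u x) = u * toQuaternion x * ((u⁻¹ : UnitQuaternion) : ℍ[ℝ]) := by
  rw [coe_inv_eq_star]
  ext
  · exact (conj_re _ _ rfl).symm
  all_goals rfl

theorem rot_eq_iff {u : UnitQuaternion} {x y : TwoSphere} :
    rot u x = y ↔ (u : ℍ[ℝ]) * toQuaternion x = toQuaternion y * u := by
  rw [← toQuaternion_injective.eq_iff, toQuaternion_rot, Metric.unitSphere.coe_inv,
    mul_inv_eq_iff_eq_mul₀ (by simpa using Metric.ne_of_mem_sphere u.2 one_ne_zero)]

@[simp] theorem rot_one (x : TwoSphere) : rot 1 x = x := by simp [rot_eq_iff]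

theorem rot_mul (u v : UnitQuaternion) (x : TwoSphere) : rot (u * v) x = rot u (rot v x) := by
  apply toQuaternion_injective
  simp only [toQuaternion_rot, mul_inv_rev, Metric.unitSphere.coe_mul, mul_assoc]

theorem rot_neg (u : UnitQuaternion) (x : TwoSphere) : rot u (-x) = -rot u x := by
  apply toQuaternion_injective
  simp [toQuaternion_rot, toQuaternion_neg]

@[fun_prop]
theorem continuous_rot {Z : Type*} [TopologicalSpace Z] {f : Z → UnitQuaternion} {g : Z → TwoSphere}
    (hf : Continuous f) (hg : Continuous g) : Continuous fun z => rot (f z) (g z) := by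
  have h : Continuous fun z => ((f z : ℍ[ℝ]) * toQuaternion (g z) * star (f z : ℍ[ℝ])) := by
    have := continuous_toQuaternion.comp hg
    fun_prop
  refine Continuous.subtype_mk ((PiLp.continuous_toLp 2 _).comp (continuous_pi fun i => ?_)) _
  fin_cases i
  exacts [Quaternion.continuous_imI.comp h, Quaternion.continuous_imJ.comp h,
    Quaternion.continuous_imK.comp h]

theorem toQuaternion_mul_self (x : TwoSphere) : toQuaternion x * toQuaternion x = -1 := by
  have := sum_sq x
  ext <;> simp [toQuaternion] <;> nlinarith

theorem one_sub_mul_ne_zero {x y : TwoSphere} (h : y ≠ -x) :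
    1 - toQuaternion y * toQuaternion x ≠ 0 := by
  intro h0
  apply h
  apply toQuaternion_injective
  rw [toQuaternion_neg]
  have h1 : (1 - toQuaternion y * toQuaternion x) * toQuaternion x = 0 := by rw [h0, zero_mul]
  rw [sub_mul, mul_assoc, toQuaternion_mul_self, one_mul, mul_neg_one, sub_neg_eq_add] at h1
  exact (neg_eq_of_add_eq_zero_right h1).symm

open Classical in
/-- The rotation along the shortest geodesic from `x` to `y`, as a unit quaternion, where `y` is
not antipodal to `x` (otherwise the value is `1`). -/
def turn (x y : TwoSphere) : UnitQuaternion :=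
  if h : y ≠ -x then ⟨‖1 - toQuaternion y * toQuaternion x‖⁻¹ •
    (1 - toQuaternion y * toQuaternion x), by
      rw [mem_sphere_zero_iff_norm, norm_smul, norm_inv, norm_norm,
        inv_mul_cancel₀ (norm_ne_zero_iff.2 (one_sub_mul_ne_zero h))]⟩ else 1

theorem rot_turn {x y : TwoSphere} (h : y ≠ -x) : rot (turn x y) x = y := by
  rw [rot_eq_iff, turn, dif_pos h]
  simp only [smul_mul_assoc, mul_smul_comm]
  congr 1
  rw [sub_mul, mul_sub, mul_assoc, toQuaternion_mul_self, ← mul_assoc, toQuaternion_mul_self]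
  simp [add_comm]

@[simp] theorem turn_self (x : TwoSphere) : turn x x = 1 := by
  ext1
  have h2 : (1 + 1 : ℍ[ℝ]) = ((2 : ℝ) : ℍ[ℝ]) := by
    rw [one_add_one_eq_two]; rfl
  rw [turn, dif_pos (ne_neg_self x)]
  simp only [toQuaternion_mul_self, sub_neg_eq_add, h2, Metric.unitSphere.coe_one]
  rw [← Quaternion.coe_smul, Quaternion.norm_coe]
  norm_num

theorem continuous_turn {Z : Type*} [TopologicalSpace Z] {f g : Z → TwoSphere}
    (hf : Continuous f) (hg : Continuous g) (h : ∀ z, g z ≠ -f z) :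
    Continuous fun z => turn (f z) (g z) := by
  have hc : Continuous fun z => 1 - toQuaternion (g z) * toQuaternion (f z) :=
    continuous_const.sub ((continuous_toQuaternion.comp hg).mul (continuous_toQuaternion.comp hf))
  rw [continuous_induced_rng]
  refine ((hc.norm.inv₀ fun z => norm_ne_zero_iff.2 (one_sub_mul_ne_zero (h z))).smul hc).congr ?_
  intro z
  change _ = ((turn (f z) (g z) : UnitQuaternion) : ℍ[ℝ])
  rw [turn, dif_pos (h z)]
  rfl

/-! ### The Hopf map -/

/-- The pole `(1, 0, 0)` of the sphere. -/
def pole : TwoSphere := ofCoords 1 0 0 (by norm_num)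

/-- The Hopf map `S³ → S²`, the orbit map of the pole. -/
def hopf (u : UnitQuaternion) : TwoSphere := rot u pole

@[fun_prop]
theorem continuous_hopf : Continuous hopf := continuous_rot continuous_id continuous_const

theorem hopf_mul (u v : UnitQuaternion) : hopf (u * v) = rot u (hopf v) := rot_mul u v pole

theorem toQuaternion_pole : toQuaternion pole = quat 0 1 0 0 := rfl

/-- The stabilizer of the pole consists of the unit complex numbers. -/
theorem hopf_eq_pole_iff {u : UnitQuaternion} :
    hopf u = pole ↔ (u : ℍ[ℝ]).imJ = 0 ∧ (u : ℍ[ℝ]).imK = 0 := by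
  rw [hopf, rot_eq_iff, toQuaternion_pole, Quaternion.ext_iff]
  simp
  constructor
  · rintro ⟨h1, h2⟩; constructor <;> linarith
  · rintro ⟨h1, h2⟩; simp [h1, h2]

/-- The quaternion `j`. -/
def quatJ : UnitQuaternion := ⟨quat 0 0 1 0, by
  rw [mem_sphere_zero_iff_norm, ← sq_eq_sq₀ (norm_nonneg _) zero_le_one, sq,
    ← Quaternion.normSq_eq_norm_mul_self, Quaternion.normSq_def']
  norm_num⟩

theorem rot_quatJ_pole : rot quatJ pole = -pole := by
  rw [rot_eq_iff, toQuaternion_neg, toQuaternion_pole, quatJ]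
  ext <;> simp

/-- The right multiplication by `j` covers the antipodal map. -/
theorem hopf_mul_quatJ (u : UnitQuaternion) : hopf (u * quatJ) = -hopf u := by
  rw [hopf, rot_mul, rot_quatJ_pole, rot_neg, hopf]

theorem hopf_surjective : Function.Surjective hopf := by
  intro x
  by_cases h : x = -pole
  · exact ⟨quatJ, h ▸ rot_quatJ_pole⟩
  · exact ⟨turn pole x, rot_turn h⟩

/-- The inclusion of the circle in the unit quaternions, whose image is the stabilizer of the
pole. -/
def ofCircle : Circle →* UnitQuaternion where
  toFun z := ⟨((z : ℂ) : ℍ[ℝ]), by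
    rw [mem_sphere_zero_iff_norm, ← sq_eq_sq₀ (norm_nonneg _) zero_le_one, sq,
      ← Quaternion.normSq_eq_norm_mul_self, Quaternion.normSq_def']
    have := Circle.normSq_coe z
    rw [Complex.normSq_apply] at this
    simp; nlinarith⟩
  map_one' := by ext1; simp
  map_mul' z w := by ext1; simp

theorem ofCircle_injective : Function.Injective ofCircle := by
  intro z w h
  have h' : ((z : ℂ) : ℍ[ℝ]) = ((w : ℂ) : ℍ[ℝ]) := congrArg Subtype.val h
  exact Circle.ext (Complex.ext (by simpa using congrArg QuaternionAlgebra.re h')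
    (by simpa using congrArg QuaternionAlgebra.imI h'))

@[fun_prop]
theorem continuous_ofCircle : Continuous ofCircle :=
  Continuous.subtype_mk ((Quaternion.ofComplex.toLinearMap.continuous_of_finiteDimensional).comp
    continuous_subtype_val) _

@[simp] theorem hopf_mul_ofCircle (u : UnitQuaternion) (z : Circle) :
    hopf (u * ofCircle z) = hopf u := by
  rw [hopf_mul, hopf_eq_pole_iff.2, hopf]
  exact ⟨rfl, rfl⟩

/-- The right multiplication by `j` reverses the Hopf circles; this is why the antipodal map changes
the sign of the degree. -/
theorem ofCircle_mul_quatJ (z : Circle) : ofCircle z * quatJ = quatJ * ofCircle z⁻¹ := by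
  ext1
  rw [Metric.unitSphere.coe_mul, Metric.unitSphere.coe_mul]
  ext <;> simp [ofCircle, quatJ]

/-- Two maps to `S³` with the same composition with the Hopf map differ by a map to the circle. -/
theorem exists_eq_mul_ofCircle {Z : Type*} [TopologicalSpace Z] (F G : C(Z, UnitQuaternion))
    (h : ∀ z, hopf (F z) = hopf (G z)) :
    ∃ c : C(Z, Circle), ∀ z, G z = F z * ofCircle (c z) := by
  have h' : ∀ z, hopf ((F z)⁻¹ * G z) = pole := fun z => by
    rw [hopf_mul, ← h, ← hopf_mul, inv_mul_cancel, hopf, rot_one]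
  let D : C(Z, UnitQuaternion) := ⟨fun z => (F z)⁻¹ * G z, by fun_prop⟩
  have hD : ∀ z, (D z : ℍ[ℝ]).imJ = 0 ∧ (D z : ℍ[ℝ]).imK = 0 := fun z => hopf_eq_pole_iff.1 (h' z)
  have hmem : ∀ z, (⟨(D z : ℍ[ℝ]).re, (D z : ℍ[ℝ]).imI⟩ : ℂ) ∈ Submonoid.unitSphere ℂ := fun z => by
    have h1 := normSq_coe (D z)
    rw [Quaternion.normSq_def', (hD z).1, (hD z).2] at h1
    refine mem_sphere_zero_iff_norm.2 ?_
    rw [← sq_eq_sq₀ (norm_nonneg _) zero_le_one, Complex.sq_norm, Complex.normSq_mk]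
    nlinarith
  refine ⟨⟨fun z => ⟨_, hmem z⟩, ?_⟩, fun z => ?_⟩
  · refine Continuous.subtype_mk ?_ _
    have hDc : Continuous fun z => (D z : ℍ[ℝ]) := by fun_prop
    exact Complex.equivRealProdCLM.symm.continuous.comp
      ((Quaternion.continuous_re.comp hDc).prodMk (Quaternion.continuous_imI.comp hDc))
  · rw [← inv_mul_eq_iff_eq_mul]
    ext1
    change (D z : ℍ[ℝ]) = _
    ext
    · rfl
    · rfl
    · exact (hD z).1
    · exact (hD z).2

end UnitQuaternion

/-! ### Parallel transport -/

namespace UnitQuaternion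

/-- Approximate parallel transport along the path `α`: the product of the rotations along the
shortest geodesics joining the successive points `α (r ⊓ s j)`, for `j ≤ m`. -/
def partialTransport (s : ℕ → I) (α : I → TwoSphere) (r : I) : ℕ → UnitQuaternion
  | 0 => 1
  | m + 1 => turn (α (r ⊓ s m)) (α (r ⊓ s (m + 1))) * partialTransport s α r m

theorem dist_inf_inf_le (r a b : I) : dist (r ⊓ a) (r ⊓ b) ≤ dist a b := by
  rw [Subtype.dist_eq, Subtype.dist_eq, Real.dist_eq, Real.dist_eq]
  have := abs_inf_sub_inf_le_abs (a : ℝ) b r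
  rw [inf_comm (a : ℝ), inf_comm (b : ℝ)] at this
  exact this

theorem ne_neg_of_dist_lt {x y : TwoSphere} (h : dist x y < 2) : y ≠ -x := by
  rintro rfl
  rw [Subtype.dist_eq, dist_eq_norm] at h
  have h1 : (x : EuclideanSpace ℝ (Fin 3)) - ((-x : TwoSphere) : EuclideanSpace ℝ (Fin 3))
      = (2 : ℝ) • x.1 := by
    rw [two_smul]; simp
  rw [h1, norm_smul, mem_sphere_zero_iff_norm.1 x.2] at h
  norm_num at h

/-- **Parallel transport** on `S²`: the paths `H (·, z)` are carried by continuous families of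
rotations, which depend only on the path and are constant for constant paths. -/
theorem exists_parallelTransport {Z : Type*} [PseudoMetricSpace Z] [CompactSpace Z]
    (H : C(I × Z, TwoSphere)) :
    ∃ Q : C(I × Z, UnitQuaternion), (∀ z, Q (0, z) = 1) ∧
      (∀ r z, rot (Q (r, z)) (H (0, z)) = H (r, z)) ∧
      (∀ z z', (∀ r, H (r, z) = H (r, z')) → ∀ r, Q (r, z) = Q (r, z')) ∧
      (∀ z, (∀ r, H (r, z) = H (0, z)) → ∀ r, Q (r, z) = 1) := by
  obtain ⟨δ, hδ, hH⟩ := Metric.uniformContinuous_iff.1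
    (CompactSpace.uniformContinuous_of_continuous H.continuous) 2 two_pos
  obtain ⟨n, hn⟩ := exists_nat_gt δ⁻¹
  have hn0 : (0 : ℝ) < n := (inv_pos.2 hδ).trans hn
  -- consecutive points `H (s j, z)` and `H (s (j + 1), z)` are not antipodal
  let s : ℕ → I := fun j => Set.projIcc (0 : ℝ) 1 zero_le_one (j / n)
  have hs0 : s 0 = 0 := by simp [s]
  have hsn : s n = 1 := Set.projIcc_of_right_le _ (by rw [div_self hn0.ne'])
  have hs : ∀ j, dist (s j) (s (j + 1)) < δ := fun j => by
    refine lt_of_le_of_lt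
      ((LipschitzWith.projIcc (zero_le_one' ℝ)).dist_le_mul ((j : ℝ) / n)
        (((j + 1 : ℕ) : ℝ) / n)) ?_
    rw [NNReal.coe_one, one_mul, Real.dist_eq, ← sub_div]
    push_cast
    rw [sub_add_cancel_left, abs_div, abs_neg, abs_one, abs_of_pos hn0, one_div]
    exact inv_lt_of_inv_lt₀ hδ hn
  have hne : ∀ j r z, H (r ⊓ s (j + 1), z) ≠ -H (r ⊓ s j, z) := fun j r z => by
    refine ne_neg_of_dist_lt (hH ?_)
    rw [Prod.dist_eq, dist_self]
    exact max_lt ((dist_inf_inf_le _ _ _).trans_lt (hs j)) hδ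
  have hcont : ∀ m, Continuous fun p : I × Z =>
      partialTransport s (fun t => H (t, p.2)) p.1 m := by
    intro m
    induction m with
    | zero => exact continuous_const
    | succ m ih =>
      refine Continuous.mul (continuous_turn (f := fun p : I × Z => H (p.1 ⊓ s m, p.2))
        (g := fun p : I × Z => H (p.1 ⊓ s (m + 1), p.2)) (by fun_prop) (by fun_prop) ?_) ih
      exact fun p => hne m p.1 p.2
  have hrot : ∀ m r z,
      rot (partialTransport s (fun t => H (t, z)) r m) (H (0, z)) = H (r ⊓ s m, z) := by
    intro m r z
    induction m with
    | zero =>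
      rw [hs0, inf_eq_right.2 unitInterval.nonneg']
      exact rot_one _
    | succ m ih => rw [partialTransport, rot_mul, ih, rot_turn (hne m r z)]
  have hconst : ∀ m z, (∀ r, H (r, z) = H (0, z)) → ∀ r,
      partialTransport s (fun t => H (t, z)) r m = 1 := by
    intro m z hz r
    induction m with
    | zero => rfl
    | succ m ih => rw [partialTransport, ih, hz, hz (r ⊓ s (m + 1)), turn_self, mul_one]
  refine ⟨⟨_, hcont n⟩, fun z => ?_, fun r z => ?_, fun z z' h r => ?_, fun z h r => hconst n z h r⟩
  · have : ∀ m, partialTransport s (fun t => H (t, z)) 0 m = 1 := fun m => by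
      induction m with
      | zero => rfl
      | succ m ih =>
        rw [partialTransport, ih, inf_eq_left.2 unitInterval.nonneg',
          inf_eq_left.2 unitInterval.nonneg', turn_self, mul_one]
    exact this n
  · have := hrot n r z
    rw [hsn, inf_eq_left.2 unitInterval.le_one'] at this
    exact this
  · change partialTransport s (fun t => H (t, z)) r n = partialTransport s (fun t => H (t, z')) r n
    rw [funext h]

end UnitQuaternion

/-! ### Logarithms of maps to the circle -/

/-- Every map from a cube to the circle has a continuous logarithm. -/
theorem Circle.exists_lift_cube {N : Type*} (c : C(I^N, Circle)) :
    ∃ θ : C(I^N, ℝ), ∀ z, Circle.exp (θ z) = c z := by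
  -- the lift starts at the constant map, to which `c` contracts radially
  let H : C(I × (I^N), Circle) := ⟨fun p => c fun i => p.1 * p.2 i, by fun_prop⟩
  obtain ⟨x, hx⟩ := Circle.exp_surjective (c 0)
  have H0 : ∀ z, H (0, z) = Circle.exp (ContinuousMap.const (I^N) x z) := fun z => by
    simp only [H, ContinuousMap.coe_mk, zero_mul, ContinuousMap.const_apply, hx]
    rfl
  let L := Circle.isCoveringMap_exp.liftHomotopy H (ContinuousMap.const _ x) H0
  refine ⟨⟨fun z => L (1, z), by fun_prop⟩, fun z => ?_⟩
  have h := congrFun (Circle.isCoveringMap_exp.liftHomotopy_lifts H (ContinuousMap.const _ x) H0)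
    (1, z)
  refine h.trans ?_
  simp [H]

/-- The homomorphism `t ↦ exp (2πit)` from the line to the circle. -/
def unitExp (t : ℝ) : Circle := Circle.exp (2 * Real.pi * t)

@[fun_prop]
theorem continuous_unitExp : Continuous unitExp := by unfold unitExp; fun_prop

@[simp] theorem unitExp_zero : unitExp 0 = 1 := by simp [unitExp]

theorem unitExp_add (s t : ℝ) : unitExp (s + t) = unitExp s * unitExp t := by
  simp [unitExp, mul_add, Circle.exp_add]

theorem unitExp_neg (t : ℝ) : unitExp (-t) = (unitExp t)⁻¹ := by
  simp [unitExp]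

theorem unitExp_eq_one_iff {t : ℝ} : unitExp t = 1 ↔ ∃ n : ℤ, t = n := by
  rw [unitExp, Circle.exp_eq_one]
  constructor
  · rintro ⟨n, hn⟩
    refine ⟨n, ?_⟩
    have := Real.pi_pos
    nlinarith
  · rintro ⟨n, rfl⟩
    exact ⟨n, by ring⟩

@[simp] theorem unitExp_intCast (n : ℤ) : unitExp n = 1 := unitExp_eq_one_iff.2 ⟨n, rfl⟩

theorem exists_unitExp_lift_cube {N : Type*} (c : C(I^N, Circle)) :
    ∃ θ : C(I^N, ℝ), ∀ z, unitExp (θ z) = c z := by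
  obtain ⟨θ, hθ⟩ := Circle.exists_lift_cube c
  refine ⟨⟨fun z => (2 * Real.pi)⁻¹ * θ z, by fun_prop⟩, fun z => ?_⟩
  change Circle.exp (2 * Real.pi * ((2 * Real.pi)⁻¹ * θ z)) = _
  rw [← hθ z, mul_inv_cancel_left₀ (by positivity)]

/-- A logarithm of a map to the circle is constant along paths where the map is `1`. -/
theorem eq_of_unitExp_eq_one {f : I → ℝ} (hf : Continuous f) (h : ∀ t, unitExp (f t) = 1)
    (s t : I) : f s = f t := by
  have hn : ∀ t, ∃ n : ℤ, f t = n := fun t => unitExp_eq_one_iff.1 (h t)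
  choose n hn using hn
  have hnc : Continuous n := by
    rw [Int.isClosedEmbedding_coe_real.isEmbedding.continuous_iff]
    exact hf.congr hn
  rw [hn, hn, PreconnectedSpace.constant inferInstance hnc]

/-! ### Free homotopies -/

namespace HomotopyGroup

theorem HomotopicAlong.of_homotopic {N X : Type*} [TopologicalSpace X] {x : X}
    {f g : Ω^ N X x} (h : GenLoop.Homotopic f g) : HomotopicAlong (Path.refl x) f g := by
  obtain ⟨H⟩ := h
  exact ⟨H.toContinuousMap, H.apply_zero, H.apply_one,
    fun t z hz => (H.eq_fst t hz).trans (f.2 z hz)⟩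

theorem HomotopicAlong.map {N X Y : Type*} [TopologicalSpace X] [TopologicalSpace Y] {x y : X}
    {γ : Path x y} {f : Ω^ N X x} {g : Ω^ N X y} (h : HomotopicAlong γ f g) (φ : C(X, Y)) :
    HomotopicAlong (γ.map φ.continuous) (genLoopMap φ f) (genLoopMap φ g) := by
  obtain ⟨H, H0, H1, Hb⟩ := h
  exact ⟨φ.comp H, fun z => congrArg φ (H0 z), fun z => congrArg φ (H1 z),
    fun t z hz => congrArg φ (Hb t z hz)⟩

theorem HomotopicAlong.homotopic_of_const {N X : Type*} [TopologicalSpace X] {x : X}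
    {γ : Path x x} {f g : Ω^ N X x} (h : HomotopicAlong γ f g) (hγ : ∀ t, γ t = x) :
    GenLoop.Homotopic f g := by
  obtain ⟨H, H0, H1, Hb⟩ := h
  exact ⟨⟨⟨H, H0, H1⟩, fun t z hz => (Hb t z hz).trans ((hγ t).trans (f.2 z hz).symm)⟩⟩

/-- A loop which is freely homotopic to a constant one is null. -/
theorem homotopic_const_of_homotopicAlong {N X : Type*} [Fintype N] [Nonempty N]
    [TopologicalSpace X] {x y : X} {γ : Path x y} {f : Ω^ N X x}
    (h : HomotopicAlong γ f GenLoop.const) : GenLoop.Homotopic f GenLoop.const := by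
  classical
  have h1 : transport γ (mk f) = 1 := mk_eq_mk h.transport_homotopic
  exact Quotient.exact ((map_eq_one_iff _ (transport γ).injective).1 h1)

end HomotopyGroup

/-! ### Low-dimensional homotopy groups of spheres -/

/-- The normalization `z ↦ f z / ‖f z‖` of a nowhere vanishing map. -/
def normalizeMap {Z E : Type*} [TopologicalSpace Z] [NormedAddCommGroup E] [NormedSpace ℝ E]
    (f : C(Z, E)) (h : ∀ z, f z ≠ 0) : C(Z, Metric.sphere (0 : E) 1) :=
  ⟨fun z => ⟨‖f z‖⁻¹ • f z, by
    rw [mem_sphere_zero_iff_norm, norm_smul, norm_inv, norm_norm,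
      inv_mul_cancel₀ (norm_ne_zero_iff.2 (h z))]⟩,
    Continuous.subtype_mk ((f.continuous.norm.inv₀ fun z => norm_ne_zero_iff.2 (h z)).smul
      f.continuous) _⟩

theorem normalizeMap_eq {Z E : Type*} [TopologicalSpace Z] [NormedAddCommGroup E] [NormedSpace ℝ E]
    {f : C(Z, E)} (h : ∀ z, f z ≠ 0) {z : Z} {u : Metric.sphere (0 : E) 1} (hu : f z = u) :
    normalizeMap f h z = u := by
  ext1
  change ‖f z‖⁻¹ • f z = u
  rw [hu, mem_sphere_zero_iff_norm.1 u.2, inv_one, one_smul]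

theorem normalizeMap_congr {Z Z' E : Type*} [TopologicalSpace Z] [TopologicalSpace Z']
    [NormedAddCommGroup E] [NormedSpace ℝ E]
    {f : C(Z, E)} {g : C(Z', E)} (h : ∀ z, f z ≠ 0) (h' : ∀ z, g z ≠ 0) {z : Z} {z' : Z'}
    (hu : f z = g z') : normalizeMap f h z = normalizeMap g h' z' := by
  ext1
  change ‖f z‖⁻¹ • f z = ‖g z'‖⁻¹ • g z'
  rw [hu]

section Sphere

variable {N E : Type*} [Fintype N] [Nonempty N] [NormedAddCommGroup E] [InnerProductSpace ℝ E]
  [FiniteDimensional ℝ E]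

open scoped ContDiff Manifold

/-- A loop in a sphere is approximated by a smooth map with the same values on the boundary of the
cube. -/
theorem exists_contDiff_approx (u : Metric.sphere (0 : E) 1)
    (f : Ω^ N (Metric.sphere (0 : E) 1) u) :
    ∃ g : (N → ℝ) → E, ContDiff ℝ 1 g ∧ (∀ z : I^N, ‖g (fun i => z i) - f z‖ < 1) ∧
      ∀ z ∈ Cube.boundary N, g (fun i => z i) = u := by
  let e : (N → ℝ) → E := fun x => f fun i => Set.projIcc 0 1 zero_le_one (x i)
  have hec : Continuous e := continuous_subtype_val.comp
    (f.1.continuous.comp (continuous_pi fun i => continuous_projIcc.comp (continuous_apply i)))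
  let U : Set (N → ℝ) := Set.univ.pi fun _ => Set.Ioo 0 1
  have hU : IsOpen U := isOpen_set_pi Set.finite_univ fun _ _ => isOpen_Ioo
  have heU : ∀ x, x ∉ U → e x = u := fun x hx => by
    simp only [U, Set.mem_pi, Set.mem_univ, true_implies, Set.mem_Ioo, not_forall, not_and_or,
      not_lt] at hx
    obtain ⟨i, hi⟩ := hx
    refine congrArg Subtype.val (f.2 _ ⟨i, ?_⟩)
    exact hi.imp (fun h => Set.projIcc_of_le_left _ h) (fun h => Set.projIcc_of_right_le _ h)
  -- outside the open cube `g` is required to be equal to `u`; near a boundary point, the constant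
  -- `u` satisfies this requirement and is close to `f`
  obtain ⟨g, hg⟩ := exists_contMDiffMap_forall_mem_convex_of_local_const (n := 1) 𝓘(ℝ, N → ℝ)
    (t := fun x => Metric.ball (e x) 1 ∩ {y | x ∉ U → y = u}) (fun x => by
      refine (convex_ball _ _).inter ?_
      by_cases hx : x ∈ U
      · simp [hx, convex_univ]
      · simp [hx]) (fun x => by
      have hnear : ∀ᶠ y in 𝓝 x, e x ∈ Metric.ball (e y) 1 := by
        filter_upwards [hec.continuousAt (Metric.ball_mem_nhds (e x) one_pos)] with y hy
        exact Metric.mem_ball'.2 hy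
      refine ⟨e x, ?_⟩
      by_cases hx : x ∈ U
      · filter_upwards [hnear, hU.mem_nhds hx] with y hy hyU
        exact ⟨hy, fun h => absurd hyU h⟩
      · filter_upwards [hnear] with y hy
        exact ⟨hy, fun _ => heU x hx⟩)
  have he : ∀ z : I^N, e (fun i => z i) = f z := fun z => by simp [e]
  refine ⟨g, g.contMDiff.contDiff, fun z => ?_, fun z hz => (hg _).2 ?_⟩
  · have := (hg fun i => z i).1
    rwa [he, mem_ball_iff_norm] at this
  · obtain ⟨i, hi⟩ := hz
    intro h
    have := h i (Set.mem_univ i)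
    rcases hi with hi | hi <;> simp [hi] at this

/-- The homotopy groups of a sphere vanish in degrees less than its dimension. -/
theorem genLoop_sphere_null (hN : Fintype.card N + 1 < Module.finrank ℝ E)
    {u : Metric.sphere (0 : E) 1} (f : Ω^ N (Metric.sphere (0 : E) 1) u) :
    GenLoop.Homotopic f GenLoop.const := by
  obtain ⟨g, hg, hfg, hgu⟩ := exists_contDiff_approx u f
  -- the cone over the image of `g` does not fill the space
  obtain ⟨v, hv⟩ : ∃ v : E, v ∉ Set.range fun p : ℝ × (N → ℝ) => p.1 • g p.2 :=
    (ContDiff.dense_compl_range_of_finrank_lt_finrank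
      (contDiff_fst.smul (hg.comp contDiff_snd)) (by simpa [add_comm] using hN)).nonempty
  have hgc : Continuous g := hg.continuous
  have hf1 : ∀ z, ‖(f z : E)‖ = 1 := fun z => mem_sphere_zero_iff_norm.1 (f z).2
  have hfc : Continuous fun z : I^N => (f z : E) := continuous_subtype_val.comp f.1.continuous
  -- the segments from `f` to `g` avoid the origin
  let A : C(I × (I^N), E) :=
    ⟨fun p => (f p.2 : E) + (p.1 : ℝ) • (g (fun i => p.2 i) - f p.2), by fun_prop⟩
  have hA : ∀ p, A p ≠ 0 := fun p h => by
    have h1 : (f p.2 : E) = -((p.1 : ℝ) • (g (fun i => p.2 i) - f p.2)) :=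
      eq_neg_of_add_eq_zero_left h
    have h2 := congrArg norm h1
    rw [hf1, norm_neg, norm_smul, Real.norm_of_nonneg p.1.2.1] at h2
    nlinarith [hfg p.2, p.1.2.1, p.1.2.2, norm_nonneg (g (fun i => p.2 i) - f p.2)]
  have hg0 : ∀ z : I^N, g (fun i => z i) ≠ 0 := fun z h => by
    refine hA (1, z) ?_
    simp [A, h]
  -- the segments from `g` to `-v` avoid the origin, since `v` is not in the cone
  let B : C(I × (I^N), E) :=
    ⟨fun p => (1 - p.1 : ℝ) • g (fun i => p.2 i) - (p.1 : ℝ) • v, by fun_prop⟩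
  have hB : ∀ p, B p ≠ 0 := fun p h => by
    have h' : (1 - p.1 : ℝ) • g (fun i => p.2 i) - (p.1 : ℝ) • v = 0 := h
    by_cases h0 : (p.1 : ℝ) = 0
    · exact hg0 p.2 (by simpa [h0] using h')
    · refine hv ⟨((p.1 : ℝ)⁻¹ * (1 - p.1), fun i => p.2 i), ?_⟩
      simp only
      rw [mul_smul, sub_eq_zero.1 h', smul_smul, inv_mul_cancel₀ h0, one_smul]
  let f' : Ω^ N (Metric.sphere (0 : E) 1) u :=
    ⟨⟨fun z => normalizeMap A hA (1, z), by fun_prop⟩, fun z hz =>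
      normalizeMap_eq hA (by simp [A, hgu z hz])⟩
  have hff' : GenLoop.Homotopic f f' := by
    refine ⟨⟨⟨normalizeMap A hA, fun z => ?_, fun z => rfl⟩, fun t z hz => ?_⟩⟩
    · exact normalizeMap_eq hA (by simp [A])
    · have h1 := f.2 z hz
      exact (normalizeMap_eq hA (by
        simp only [A, ContinuousMap.coe_mk, hgu z hz]
        rw [show f z = u from h1, sub_self, smul_zero, add_zero])).trans h1.symm
  refine hff'.trans ?_
  let z₀ : I^N := 0
  have hz₀ : z₀ ∈ Cube.boundary N := ⟨Classical.arbitrary N, Or.inl rfl⟩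
  let γ : Path u (normalizeMap B hB (1, z₀)) :=
    ⟨⟨fun t => normalizeMap B hB (t, z₀), by fun_prop⟩,
      normalizeMap_eq hB (by simp [B, hgu z₀ hz₀]), rfl⟩
  refine HomotopyGroup.homotopic_const_of_homotopicAlong (γ := γ) ⟨normalizeMap B hB, ?_, ?_, ?_⟩
  · exact fun z => normalizeMap_congr hB hA (by simp [A, B])
  · exact fun z => normalizeMap_congr hB hB (by simp [B])
  · intro t z hz
    exact normalizeMap_congr hB hB (by simp [B, hgu z hz, hgu z₀ hz₀])

end Sphere

/-! ### The degree of a two-dimensional loop -/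

theorem vecTwo_eta {X : Type*} (z : Fin 2 → X) : ![z 0, z 1] = z := by
  ext i; fin_cases i <;> rfl

namespace TwoSphere

open UnitQuaternion HomotopyGroup

variable {x y : TwoSphere}

/-- `F` is a lift along the Hopf map of the `2`-dimensional loop `f`, constant with value `u` on
three sides of the square and winding `d` times around the Hopf circle of `u` on the fourth one. -/
structure IsHopfLift (f : Ω^ (Fin 2) TwoSphere x) (u : UnitQuaternion) (d : ℤ)
    (F : C(I × I, UnitQuaternion)) : Prop where
  lift : ∀ s t, hopf (F (s, t)) = f ![s, t]
  left : ∀ t, F (0, t) = u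
  bot : ∀ s, F (s, 0) = u
  top : ∀ s, F (s, 1) = u
  right : ∀ t : I, F (1, t) = u * ofCircle (unitExp (d * t))

/-- The `2`-dimensional loop `f` has degree `d`. -/
def HasDegree (f : Ω^ (Fin 2) TwoSphere x) (d : ℤ) : Prop :=
  ∃ u F, IsHopfLift f u d F

theorem boundary_two_cases {z : I^(Fin 2)} (hz : z ∈ Cube.boundary (Fin 2)) :
    z = ![0, z 1] ∨ z = ![1, z 1] ∨ z = ![z 0, 0] ∨ z = ![z 0, 1] := by
  obtain ⟨i, hi⟩ := hz
  fin_cases i <;> rcases hi with hi | hi <;> rw [← vecTwo_eta z] <;> simp at hi <;> simp [hi]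

/-- The lift by parallel transport of the paths `s ↦ f ![s, t]` is constant on three sides of the
square and takes values in a Hopf circle on the fourth one. -/
theorem exists_hasDegree (f : Ω^ (Fin 2) TwoSphere x) : ∃ d, HasDegree f d := by
  obtain ⟨u, hu⟩ := hopf_surjective x
  have hb : ∀ {z}, z ∈ Cube.boundary (Fin 2) → f z = x := fun {z} hz => f.2 z hz
  have hf : Continuous f := f.1.continuous
  let H : C(I × I, TwoSphere) := ⟨fun p => f ![p.1, p.2], by fun_prop⟩
  have hH0 : ∀ t, H (0, t) = x := fun t => hb ⟨0, Or.inl rfl⟩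
  obtain ⟨Q, Q0, QH, -, Qc⟩ := exists_parallelTransport H
  have hQ : ∀ s t, hopf (Q (s, t) * u) = f ![s, t] := fun s t => by
    rw [hopf_mul, hu]
    exact (congrArg _ (hH0 t).symm).trans (QH s t)
  have Qbot : ∀ s, Q (s, 0) = 1 := Qc 0 fun s => (hb ⟨1, Or.inl rfl⟩).trans (hH0 0).symm
  have Qtop : ∀ s, Q (s, 1) = 1 := Qc 1 fun s => (hb ⟨1, Or.inr rfl⟩).trans (hH0 1).symm
  obtain ⟨c, hc⟩ := exists_eq_mul_ofCircle (ContinuousMap.const I u)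
    ⟨fun t => Q (1, t) * u, by fun_prop⟩ fun t => by
      change hopf u = hopf (Q (1, t) * u)
      rw [hQ, hu, hb ⟨0, Or.inr rfl⟩]
  replace hc : ∀ t, Q (1, t) * u = u * ofCircle (c t) := hc
  have hc1 : ∀ t, Q (1, t) = 1 → c t = 1 := fun t ht => by
    have := hc t
    rw [ht, one_mul, left_eq_mul] at this
    exact ofCircle_injective (this.trans (map_one _).symm)
  obtain ⟨θ, hθ⟩ := exists_unitExp_lift_cube (N := Unit) ⟨fun z => c (z ()), by fun_prop⟩
  replace hθ : ∀ t, unitExp (θ fun _ => t) = c t := fun t => hθ fun _ => t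
  obtain ⟨m, hm⟩ := unitExp_eq_one_iff.1 ((hθ 0).trans (hc1 0 (Qbot 1)))
  obtain ⟨n, hn⟩ := unitExp_eq_one_iff.1 ((hθ 1).trans (hc1 1 (Qtop 1)))
  -- the last factor straightens the path in the Hopf circle to one of constant speed
  refine ⟨n - m, u, ⟨fun p => Q p * u *
    ofCircle (unitExp (p.1 * ((n - m : ℤ) * p.2 + m - θ fun _ => p.2))), by fun_prop⟩, ?_⟩
  constructor
  · intro s t
    simp [hQ]
  · intro t
    simp [Q0]
  · intro s
    simp [Qbot, hm]
  · intro s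
    simp [Qtop, hn]
  · intro t
    change Q (1, t) * u * ofCircle (unitExp ((1 : I) * ((n - m : ℤ) * t + m - θ fun _ => t))) = _
    rw [hc, mul_assoc, ← map_mul, ← hθ, ← unitExp_add, Set.Icc.coe_one, one_mul,
      add_sub_cancel, unitExp_add, unitExp_intCast, mul_one]

/-- The degree is invariant under free homotopies: on the boundary of the square, the parallel
transport along the homotopy is a single rotation. -/
theorem HasDegree.of_homotopicAlong {γ : Path x y} {f : Ω^ (Fin 2) TwoSphere x}
    {g : Ω^ (Fin 2) TwoSphere y} {d : ℤ} (h : HasDegree f d) (hfg : HomotopicAlong γ f g) :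
    HasDegree g d := by
  obtain ⟨u, F, hF⟩ := h
  obtain ⟨H, H0, H1, Hb⟩ := hfg
  obtain ⟨Q, -, QH, Qb, -⟩ := exists_parallelTransport H
  have hQ : ∀ z ∈ Cube.boundary (Fin 2), Q (1, z) = Q (1, ![0, 0]) := fun z hz =>
    Qb _ _ (fun r => (Hb r _ hz).trans (Hb r _ ⟨0, Or.inl rfl⟩).symm) 1
  refine ⟨Q (1, ![0, 0]) * u, ⟨fun p => Q (1, ![p.1, p.2]) * F p, by fun_prop⟩, ?_⟩
  constructor
  · intro s t
    change hopf (Q (1, ![s, t]) * F (s, t)) = _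
    rw [hopf_mul, hF.lift, ← H0, QH, H1]
  · intro t
    change Q (1, ![0, t]) * F (0, t) = _
    rw [hF.left, hQ _ ⟨0, Or.inl rfl⟩]
  · intro s
    change Q (1, ![s, 0]) * F (s, 0) = _
    rw [hF.bot, hQ _ ⟨1, Or.inl rfl⟩]
  · intro s
    change Q (1, ![s, 1]) * F (s, 1) = _
    rw [hF.top, hQ _ ⟨1, Or.inr rfl⟩]
  · intro t
    change Q (1, ![1, t]) * F (1, t) = _
    rw [hF.right, hQ _ ⟨0, Or.inr rfl⟩, mul_assoc]

/-- Two lifts differ by a map to the circle, and the winding number along the boundary of the square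
of a map that extends to the square is zero. -/
theorem HasDegree.unique {f : Ω^ (Fin 2) TwoSphere x} {d e : ℤ} (hd : HasDegree f d)
    (he : HasDegree f e) : d = e := by
  obtain ⟨u, F, hF⟩ := hd
  obtain ⟨v, G, hG⟩ := he
  obtain ⟨c, hc⟩ := exists_eq_mul_ofCircle F G fun p => (hF.lift p.1 p.2).trans (hG.lift _ _).symm
  have h00 := hc (0, 0)
  rw [hF.left, hG.left] at h00
  have hside : ∀ p, F p = u → G p = v → c p = c (0, 0) := fun p h1 h2 => by
    have := hc p
    rw [h1, h2, h00] at this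
    exact (ofCircle_injective (mul_left_cancel this)).symm
  have hright : ∀ t : I, c (1, t) = c (0, 0) * unitExp ((e - d) * t) := fun t => by
    have := hc (1, t)
    rw [hF.right, hG.right, h00, mul_assoc, mul_assoc, ← map_mul, ← map_mul] at this
    have h2 := ofCircle_injective (mul_left_cancel this)
    rw [sub_mul, sub_eq_add_neg, unitExp_add, ← mul_assoc, h2, unitExp_neg, mul_comm,
      inv_mul_cancel_left]
  obtain ⟨θ, hθ⟩ := exists_unitExp_lift_cube (N := Fin 2) ⟨fun z => c (z 0, z 1), by fun_prop⟩
  replace hθ : ∀ s t, unitExp (θ ![s, t]) = c (s, t) := fun s t => hθ ![s, t]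
  have hone : ∀ s t, c (s, t) = c (0, 0) → unitExp (θ ![s, t] - θ ![0, 0]) = 1 := fun s t h => by
    rw [sub_eq_add_neg, unitExp_add, unitExp_neg, hθ, hθ, h, mul_inv_cancel]
  -- follow a logarithm of `c` along the four sides of the square
  have e1 := eq_of_unitExp_eq_one (f := fun t => θ ![0, t] - θ ![0, 0]) (by fun_prop)
    (fun t => hone 0 t (hside _ (hF.left t) (hG.left t))) 0 1
  have e2 := eq_of_unitExp_eq_one (f := fun s => θ ![s, 0] - θ ![0, 0]) (by fun_prop)
    (fun s => hone s 0 (hside _ (hF.bot s) (hG.bot s))) 0 1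
  have e3 := eq_of_unitExp_eq_one (f := fun s => θ ![s, 1] - θ ![0, 0]) (by fun_prop)
    (fun s => hone s 1 (hside _ (hF.top s) (hG.top s))) 0 1
  have e4 := eq_of_unitExp_eq_one (f := fun t => θ ![1, t] - θ ![0, 0] - (e - d) * t) (by fun_prop)
    (fun t => by
      rw [sub_eq_add_neg, sub_eq_add_neg, unitExp_add, unitExp_add, unitExp_neg, unitExp_neg, hθ,
        hθ, hright, mul_right_comm, mul_inv_cancel_right, mul_inv_cancel]) 0 1
  simp only [Set.Icc.coe_zero, Set.Icc.coe_one, mul_zero, mul_one] at e4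
  have : (d : ℝ) = e := by linarith
  exact_mod_cast this

/-- The degree can be computed with a lift starting at any point of the Hopf circle. -/
theorem HasDegree.exists_lift {f : Ω^ (Fin 2) TwoSphere x} {d : ℤ} (h : HasDegree f d)
    {v : UnitQuaternion} (hv : hopf v = x) : ∃ F, IsHopfLift f v d F := by
  obtain ⟨u, F, hF⟩ := h
  have hu : hopf u = x := by
    rw [← hF.left 0, hF.lift]
    exact f.2 _ ⟨0, Or.inl rfl⟩
  obtain ⟨c, hc⟩ := exists_eq_mul_ofCircle (ContinuousMap.const Unit u) (ContinuousMap.const Unit v)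
    fun _ => hu.trans hv.symm
  replace hc : v = u * ofCircle (c ()) := hc ()
  refine ⟨⟨fun p => F p * ofCircle (c ()), by fun_prop⟩, ?_⟩
  constructor
  · intro s t
    simp [hF.lift]
  · intro t
    simp [hF.left, hc]
  · intro t
    simp [hF.bot, hc]
  · intro t
    simp [hF.top, hc]
  · intro t
    simp only [ContinuousMap.coe_mk, hF.right, hc, mul_assoc, ← map_mul]
    rw [mul_comm (unitExp _)]

theorem HasDegree.transAt {f g : Ω^ (Fin 2) TwoSphere x} {d e : ℤ} (hf : HasDegree f d)
    (hg : HasDegree g e) : HasDegree (GenLoop.transAt 0 f g) (d + e) := by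
  obtain ⟨u, hu⟩ := hopf_surjective x
  obtain ⟨F, hF⟩ := hf.exists_lift hu
  obtain ⟨G, hG⟩ := hg.exists_lift hu
  -- rotating `G` along the Hopf circles makes its left side match the right side of `F`
  refine ⟨u, ⟨fun p => if (p.1 : ℝ) ≤ 1 / 2
    then F (Set.projIcc 0 1 zero_le_one (2 * (p.1 : ℝ)), p.2)
    else G (Set.projIcc 0 1 zero_le_one (2 * (p.1 : ℝ) - 1), p.2) * ofCircle (unitExp (d * p.2)),
      ?_⟩, ?_⟩
  · have hp : ∀ c : ℝ, Continuous fun p : I × I =>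
        ((Set.projIcc (0 : ℝ) 1 zero_le_one (2 * (p.1 : ℝ) - c), p.2) : I × I) := fun c =>
      (continuous_projIcc.comp (by fun_prop)).prodMk continuous_snd
    refine Continuous.if_le (F.continuous.comp (by simpa using hp 0))
      ((G.continuous.comp (hp 1)).mul (by fun_prop)) (by fun_prop) continuous_const ?_
    intro p hp
    rw [hp, Set.projIcc_of_right_le _ (by norm_num), Set.projIcc_of_le_left _ (by norm_num)]
    exact (hF.right p.2).trans (by rw [← hG.left p.2]; rfl)
  · constructor
    · intro s t
      change hopf (ite _ _ _) = ite _ _ _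
      have h0 : ∀ a : I, Function.update ![s, t] 0 a = ![a, t] := fun a => by
        ext i; fin_cases i <;> simp
      simp only [h0, Matrix.cons_val_zero]
      split_ifs
      · rw [hF.lift]
      · rw [hopf_mul_ofCircle, hG.lift]
    · intro t
      simp [hF.left]
    · intro s
      simp [hF.bot, hG.bot]
    · intro s
      simp [hF.top, hG.top]
    · intro t
      norm_num [hG.right]
      rw [mul_assoc, ← map_mul, ← unitExp_add, add_mul, add_comm]

/-- Loops of the same degree are homotopic: their lifts agree on the boundary of the square, hence
they are homotopic because `π₂(S³) = 0`. -/
theorem HasDegree.homotopic {f g : Ω^ (Fin 2) TwoSphere x} {d : ℤ} (hf : HasDegree f d)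
    (hg : HasDegree g d) : GenLoop.Homotopic f g := by
  obtain ⟨u, hu⟩ := hopf_surjective x
  obtain ⟨F, hF⟩ := hf.exists_lift hu
  obtain ⟨G, hG⟩ := hg.exists_lift hu
  let K : Ω^ (Fin 2) UnitQuaternion 1 :=
    ⟨⟨fun z => (F (z 0, z 1))⁻¹ * G (z 0, z 1), by fun_prop⟩, fun z hz => by
      change (F (z 0, z 1))⁻¹ * G (z 0, z 1) = 1
      rw [inv_mul_eq_one]
      rcases boundary_two_cases hz with h | h | h | h <;> rw [h] <;>
        simp [hF.left, hG.left, hF.bot, hG.bot, hF.top, hG.top, hF.right, hG.right]⟩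
  obtain ⟨H⟩ := genLoop_sphere_null (by rw [Quaternion.finrank_eq_four]; simp) K
  refine GenLoop.Homotopic.symm
    ⟨⟨⟨⟨fun p => hopf (F (p.2 0, p.2 1) * H p), by fun_prop⟩, fun z => ?_, fun z => ?_⟩, ?_⟩⟩
  · change hopf (F (z 0, z 1) * H (0, z)) = g z
    rw [H.apply_zero]
    change hopf (F (z 0, z 1) * ((F (z 0, z 1))⁻¹ * G (z 0, z 1))) = g z
    rw [mul_inv_cancel_left, hG.lift, vecTwo_eta]
  · change hopf (F (z 0, z 1) * H (1, z)) = f z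
    rw [H.apply_one]
    change hopf (F (z 0, z 1) * 1) = f z
    rw [mul_one, hF.lift, vecTwo_eta]
  · intro r z hz
    change hopf (F (z 0, z 1) * H (r, z)) = g z
    have h1 : H (r, z) = 1 := (H.eq_fst r hz).trans (K.2 z hz)
    rw [h1, mul_one, hF.lift, vecTwo_eta]
    exact (f.2 z hz).trans (g.2 z hz).symm

theorem exists_of_degree (x : TwoSphere) (d : ℤ) :
    ∃ f : Ω^ (Fin 2) TwoSphere x, HasDegree f d := by
  obtain ⟨u, hu⟩ := hopf_surjective x
  have hc : Continuous fun p : I × I => (ofCircle (unitExp (d * p.2)) : ℍ[ℝ]) :=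
    continuous_subtype_val.comp (by fun_prop)
  -- the segments from `1` to the circle, pushed away from the origin in the direction of `j`
  have hPc : Continuous fun p : I × I => (1 - p.1 : ℝ) • (1 : ℍ[ℝ]) +
      (p.1 : ℝ) • (ofCircle (unitExp (d * p.2)) : ℍ[ℝ]) +
      ((p.1 : ℝ) * (1 - p.1) * p.2 * (1 - p.2)) • (quatJ : ℍ[ℝ]) := by
    have h1 : Continuous fun p : I × I => (1 - p.1 : ℝ) := by fun_prop
    have h2 : Continuous fun p : I × I => (p.1 : ℝ) := by fun_prop
    have h3 : Continuous fun p : I × I => (p.1 : ℝ) * (1 - p.1) * p.2 * (1 - p.2) := by fun_prop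
    exact ((h1.smul continuous_const).add (h2.smul hc)).add (h3.smul continuous_const)
  let P : C(I × I, ℍ[ℝ]) := ⟨_, hPc⟩
  have P0 : ∀ t, P (0, t) = (1 : UnitQuaternion) := fun t => by simp [P]
  have P1 : ∀ t, P (1, t) = (ofCircle (unitExp (d * t)) : UnitQuaternion) := fun t => by simp [P]
  have P2 : ∀ s, P (s, 0) = (1 : UnitQuaternion) := fun s => by simp [P, ← add_smul]
  have P3 : ∀ s, P (s, 1) = (1 : UnitQuaternion) := fun s => by simp [P, ← add_smul]
  have hne : ∀ u : UnitQuaternion, (u : ℍ[ℝ]) ≠ 0 := fun u =>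
    Metric.ne_of_mem_sphere u.2 one_ne_zero
  have hP : ∀ p, P p ≠ 0 := by
    rintro ⟨s, t⟩ h
    have hJ := congrArg QuaternionAlgebra.imJ h
    simp [P, quatJ, ofCircle, sub_eq_zero] at hJ
    rcases hJ with ((hs | hs) | ht) | ht
    · exact hne _ ((P0 t).symm.trans (by rw [← h, hs]))
    · exact hne _ ((P1 t).symm.trans (by rw [← h, (Subtype.ext hs.symm : s = 1)]))
    · exact hne _ ((P2 s).symm.trans (by rw [← h, ht]))
    · exact hne _ ((P3 s).symm.trans (by rw [← h, (Subtype.ext ht.symm : t = 1)]))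
  let F : C(I × I, UnitQuaternion) := ⟨fun p => u * normalizeMap P hP p, by fun_prop⟩
  have F0 : ∀ t, F (0, t) = u := fun t => by
    simp only [F, ContinuousMap.coe_mk, normalizeMap_eq hP (P0 t), mul_one]
  have F1 : ∀ t : I, F (1, t) = u * ofCircle (unitExp (d * t)) := fun t => by
    simp only [F, ContinuousMap.coe_mk, normalizeMap_eq hP (P1 t)]
  have F2 : ∀ s, F (s, 0) = u := fun s => by
    simp only [F, ContinuousMap.coe_mk, normalizeMap_eq hP (P2 s), mul_one]
  have F3 : ∀ s, F (s, 1) = u := fun s => by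
    simp only [F, ContinuousMap.coe_mk, normalizeMap_eq hP (P3 s), mul_one]
  refine ⟨⟨⟨fun z => hopf (F (z 0, z 1)), by fun_prop⟩, fun z hz => ?_⟩, u, F,
    fun s t => rfl, F0, F2, F3, F1⟩
  change hopf (F (z 0, z 1)) = x
  rcases boundary_two_cases hz with h | h | h | h <;> rw [h] <;> simp [F0, F1, F2, F3, hu]

/-- The antipodal map of the sphere. -/
def antipode : C(TwoSphere, TwoSphere) := ⟨fun x => -x, continuous_neg⟩

/-- The antipodal map changes the sign of the degree. -/
theorem HasDegree.antipode {f : Ω^ (Fin 2) TwoSphere x} {d : ℤ} (h : HasDegree f d) :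
    HasDegree (genLoopMap antipode f) (-d) := by
  obtain ⟨u, F, hF⟩ := h
  refine ⟨u * quatJ, ⟨fun p => F p * quatJ, by fun_prop⟩, ?_⟩
  constructor
  · intro s t
    simp only [ContinuousMap.coe_mk, hopf_mul_quatJ, hF.lift]
    rfl
  · intro t
    simp [hF.left]
  · intro s
    simp [hF.bot]
  · intro s
    simp [hF.top]
  · intro t
    change F (1, t) * quatJ = u * quatJ * _
    rw [hF.right, mul_assoc, ofCircle_mul_quatJ, ← unitExp_neg, mul_assoc, Int.cast_neg,
      neg_mul (d : ℝ)]

/-- The degree of a `2`-dimensional loop. -/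
def loopDegree (f : Ω^ (Fin 2) TwoSphere x) : ℤ := (exists_hasDegree f).choose

theorem hasDegree_loopDegree (f : Ω^ (Fin 2) TwoSphere x) : HasDegree f (loopDegree f) :=
  (exists_hasDegree f).choose_spec

/-- The degree homomorphism `π₂(S²) → ℤ`. -/
def degree (x : TwoSphere) : π_ 2 TwoSphere x →* Multiplicative ℤ :=
  MonoidHom.mk' (Quotient.lift (fun f => Multiplicative.ofAdd (loopDegree f)) fun f g h =>
    congrArg _ (((hasDegree_loopDegree f).of_homotopicAlong (.of_homotopic h)).unique
      (hasDegree_loopDegree g))) (by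
    rintro ⟨f⟩ ⟨g⟩
    change Quotient.lift _ _ (mk f * mk g) = _
    rw [mk_mul_mk 0]
    change Multiplicative.ofAdd (loopDegree _) =
      Multiplicative.ofAdd (loopDegree f) * Multiplicative.ofAdd (loopDegree g)
    rw [← ofAdd_add, (hasDegree_loopDegree _).unique
      ((hasDegree_loopDegree g).transAt (hasDegree_loopDegree f)), add_comm])

theorem degree_mk {f : Ω^ (Fin 2) TwoSphere x} {d : ℤ} (h : HasDegree f d) :
    degree x (mk f) = Multiplicative.ofAdd d :=
  congrArg Multiplicative.ofAdd ((hasDegree_loopDegree f).unique h)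

theorem degree_bijective (x : TwoSphere) : Function.Bijective (degree x) := by
  constructor
  · rintro ⟨f⟩ ⟨g⟩ h
    have h' : loopDegree f = loopDegree g := Multiplicative.ofAdd.injective h
    exact mk_eq_mk ((h' ▸ hasDegree_loopDegree f).homotopic (hasDegree_loopDegree g))
  · intro d
    obtain ⟨f, hf⟩ := exists_of_degree x d.toAdd
    exact ⟨mk f, degree_mk hf⟩

end TwoSphere

/-! ### Loops of dimension at least three -/

/-- The boundary of a cube of dimension at least two is connected, so that a logarithm of a map
which is `1` on the boundary is constant there. -/
theorem eq_of_unitExp_eq_one_of_boundary {N : Type*} [Nontrivial N] (θ : C(I^N, ℝ))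
    (h : ∀ z ∈ Cube.boundary N, unitExp (θ z) = 1) {z : I^N} (hz : z ∈ Cube.boundary N) :
    θ z = θ 0 := by
  classical
  obtain ⟨i, hi⟩ := hz
  obtain ⟨j, hj⟩ := exists_ne i
  -- in the face of `z`, contract all other coordinates to `0`
  have e1 := eq_of_unitExp_eq_one
    (f := fun t => θ fun l => if l = i then z i else t * z l)
    (θ.continuous.comp (continuous_pi fun l => by split_ifs <;> fun_prop))
    (fun t => h _ ⟨i, by simpa using hi⟩) 1 0
  -- the remaining segment to `0` is contained in the face where the `j`-th coordinate vanishes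
  have e2 := eq_of_unitExp_eq_one
    (f := fun t => θ fun l => t * if l = i then z i else 0 * z l) (by fun_prop)
    (fun t => h _ ⟨j, by simp [hj]⟩) 1 0
  have h1 : (fun l => if l = i then z i else 1 * z l) = z := by
    ext l; split_ifs with hl <;> simp [hl]
  have h2 : (fun l => (1 : I) * if l = i then z i else 0 * z l) =
      fun l => if l = i then z i else 0 * z l := by
    ext l; simp
  have h3 : (fun l => (0 : I) * if l = i then z i else 0 * z l) = 0 := by
    ext l; simp
  simp only [h1] at e1
  simp only [h2, h3] at e2
  exact e1.trans e2

namespace UnitQuaternion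

instance : PathConnectedSpace UnitQuaternion :=
  isPathConnected_iff_pathConnectedSpace.1 (isPathConnected_sphere (by
    rw [← Module.finrank_eq_rank, Quaternion.finrank_eq_four]; norm_num) 0 zero_le_one)

/-- Conjugate loops in the connected group `S³` are homotopic. -/
theorem homotopic_conj {N : Type*} (v : UnitQuaternion) {φ ψ : Ω^ N UnitQuaternion 1}
    (h : ∀ z, ψ z = v * φ z * v⁻¹) : GenLoop.Homotopic ψ φ := by
  let p : Path v 1 := PathConnectedSpace.somePath v 1
  have hφ : Continuous φ := φ.1.continuous
  refine ⟨⟨⟨⟨fun q => p q.1 * φ q.2 * (p q.1)⁻¹, by fun_prop⟩, fun z => ?_, fun z => ?_⟩, ?_⟩⟩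
  · change p 0 * φ z * (p 0)⁻¹ = ψ z
    rw [h, p.source]
  · change p 1 * φ z * (p 1)⁻¹ = φ z
    rw [p.target, one_mul, inv_one, mul_one]
  · intro t z hz
    change p t * φ z * (p t)⁻¹ = ψ z
    have h1 : φ z = 1 := φ.2 z hz
    have h2 : ψ z = 1 := ψ.2 z hz
    rw [h1, h2, mul_one, mul_inv_cancel]

end UnitQuaternion

namespace TwoSphere

open UnitQuaternion HomotopyGroup

variable {N : Type*} {x y : TwoSphere}

/-- The loop `f` is, up to a rotation of the sphere and a homotopy in `S³`, the composition of the
loop `φ` in `S³` with the Hopf map. -/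
def HasHopfClass (f : Ω^ N TwoSphere x) (φ : Ω^ N UnitQuaternion 1) : Prop :=
  ∃ (u : UnitQuaternion) (ψ : Ω^ N UnitQuaternion 1),
    (∀ z, f z = hopf (u * ψ z)) ∧ GenLoop.Homotopic ψ φ

/-- The lift by parallel transport has values in a Hopf circle on the last face; as a map to the
circle it has a logarithm which is constant on the boundary of the face, so that it can be rotated
to a lift which is constant on the whole boundary of the cube. -/
theorem exists_hasHopfClass {m : ℕ} (hm : 2 ≤ m) (f : Ω^ (Fin (m + 1)) TwoSphere x) :
    ∃ φ, HasHopfClass f φ := by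
  have : Nontrivial (Fin m) := Fin.nontrivial_iff_two_le.2 hm
  obtain ⟨u, hu⟩ := hopf_surjective x
  have hf : Continuous f := f.1.continuous
  have hb : ∀ {z}, z ∈ Cube.boundary (Fin (m + 1)) → f z = x := fun {z} hz => f.2 z hz
  let H : C(I × (I^(Fin m)), TwoSphere) :=
    ⟨fun p => f (Fin.cons p.1 p.2),
      hf.comp (Continuous.finCons (A := fun _ => I) continuous_fst continuous_snd)⟩
  have hH0 : ∀ z, H (0, z) = x := fun z => hb ⟨0, Or.inl rfl⟩
  obtain ⟨Q, Q0, QH, -, Qc⟩ := exists_parallelTransport H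
  have hQ : ∀ s z, hopf (Q (s, z) * u) = f (Fin.cons s z) := fun s z => by
    rw [hopf_mul, hu]
    exact (congrArg _ (hH0 z).symm).trans (QH s z)
  have Qb : ∀ z ∈ Cube.boundary (Fin m), ∀ s, Q (s, z) = 1 := fun z hz =>
    Qc z fun s => by
      obtain ⟨i, hi⟩ := hz
      exact (hb ⟨i.succ, by simpa using hi⟩).trans (hH0 z).symm
  obtain ⟨c, hc⟩ := exists_eq_mul_ofCircle (ContinuousMap.const (I^(Fin m)) u)
    ⟨fun z => Q (1, z) * u, by fun_prop⟩ fun z => by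
      change hopf u = hopf (Q (1, z) * u)
      rw [hQ, hu, hb ⟨0, Or.inr rfl⟩]
  replace hc : ∀ z, Q (1, z) * u = u * ofCircle (c z) := hc
  obtain ⟨θ, hθ⟩ := exists_unitExp_lift_cube c
  have hθ1 : ∀ z ∈ Cube.boundary (Fin m), unitExp (θ z) = 1 := fun z hz => by
    have := hc z
    rw [Qb z hz, one_mul, left_eq_mul] at this
    rw [hθ]
    exact ofCircle_injective (this.trans (map_one _).symm)
  have hθb : ∀ z ∈ Cube.boundary (Fin m), θ z = θ 0 := fun z hz =>
    eq_of_unitExp_eq_one_of_boundary θ hθ1 hz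
  have hθ0 : unitExp (θ 0) = 1 := hθ1 0 ⟨⟨0, by omega⟩, Or.inl rfl⟩
  let φ : Ω^ (Fin (m + 1)) UnitQuaternion 1 :=
    ⟨⟨fun z => u⁻¹ * (Q (z 0, Fin.tail z) * u) *
      ofCircle (unitExp (z 0 * (θ 0 - θ (Fin.tail z)))), by unfold Fin.tail; fun_prop⟩, by
      intro z hz
      change u⁻¹ * (Q (z 0, Fin.tail z) * u) *
        ofCircle (unitExp (z 0 * (θ 0 - θ (Fin.tail z)))) = 1
      by_cases ht : Fin.tail z ∈ Cube.boundary (Fin m)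
      · simp [Qb _ ht, hθb _ ht]
      · obtain ⟨i, hi⟩ := hz
        induction i using Fin.cases with
        | zero =>
          rcases hi with hi | hi <;> rw [hi]
          · simp [Q0]
          · rw [hc, inv_mul_cancel_left, ← map_mul, ← hθ, ← unitExp_add, Set.Icc.coe_one, one_mul,
              add_sub_cancel, hθ0, map_one]
        | succ i => exact absurd ⟨i, hi⟩ ht⟩
  refine ⟨φ, u, φ, fun z => ?_, .refl _⟩
  change f z = hopf (u * (u⁻¹ * (Q (z 0, Fin.tail z) * u) *
    ofCircle (unitExp (z 0 * (θ 0 - θ (Fin.tail z))))))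
  rw [← mul_assoc, hopf_mul_ofCircle, mul_inv_cancel_left, hQ, Fin.cons_self_tail]

/-- The class is invariant under free homotopies; the motion of the base point in `S³` along the
lifted homotopy is undone by a left multiplication. -/
theorem HasHopfClass.of_homotopicAlong [Finite N] [Nonempty N] {γ : Path x y}
    {f : Ω^ N TwoSphere x} {g : Ω^ N TwoSphere y} {φ : Ω^ N UnitQuaternion 1}
    (h : HasHopfClass f φ) (hfg : HomotopicAlong γ f g) : HasHopfClass g φ := by
  have := Fintype.ofFinite N
  obtain ⟨u, ψ, hu, hψ⟩ := h
  obtain ⟨H, H0, H1, Hb⟩ := hfg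
  obtain ⟨Q, Q0, QH, Qb, -⟩ := exists_parallelTransport H
  have hψc : Continuous ψ := ψ.1.continuous
  have hQ : ∀ r, ∀ z ∈ Cube.boundary N, Q (r, z) = Q (r, 0) := fun r z hz =>
    Qb _ _ (fun r => (Hb r _ hz).trans (Hb r _ ⟨Classical.arbitrary N, Or.inl rfl⟩).symm) r
  have hb : ∀ r, ∀ z ∈ Cube.boundary N, u⁻¹ * ((Q (r, 0))⁻¹ * Q (r, z)) * u * ψ z = 1 :=
    fun r z hz => by
      have h1 : ψ z = 1 := ψ.2 z hz
      rw [hQ r z hz, h1, inv_mul_cancel, mul_one, mul_one, inv_mul_cancel]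
  refine ⟨Q (1, 0) * u, ⟨⟨fun z => u⁻¹ * ((Q (1, 0))⁻¹ * Q (1, z)) * u * ψ z, by fun_prop⟩, hb 1⟩,
    fun z => ?_, .trans (.symm ?_) hψ⟩
  · have h1 : Q (1, 0) * u * (u⁻¹ * ((Q (1, 0))⁻¹ * Q (1, z)) * u * ψ z) =
        Q (1, z) * (u * ψ z) := by group
    change g z = hopf (Q (1, 0) * u * (u⁻¹ * ((Q (1, 0))⁻¹ * Q (1, z)) * u * ψ z))
    rw [h1, hopf_mul, ← hu, ← H0, QH, H1]
  · refine ⟨⟨⟨⟨fun p => u⁻¹ * ((Q (p.1, 0))⁻¹ * Q p) * u * ψ p.2, by fun_prop⟩, fun z => ?_,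
      fun z => rfl⟩, fun r z hz => (hb r z hz).trans (ψ.2 z hz).symm⟩⟩
    change u⁻¹ * ((Q (0, 0))⁻¹ * Q (0, z)) * u * ψ z = ψ z
    rw [Q0, Q0]
    group

/-- Loops of the same class are homotopic, since a change of the point `u` in its Hopf circle
amounts to a conjugation. -/
theorem HasHopfClass.homotopic [Nonempty N] {f g : Ω^ N TwoSphere x} {φ : Ω^ N UnitQuaternion 1}
    (hf : HasHopfClass f φ) (hg : HasHopfClass g φ) : GenLoop.Homotopic f g := by
  obtain ⟨u, ψ, hu, hψ⟩ := hf
  obtain ⟨v, χ, hv, hχ⟩ := hg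
  have hz0 : (0 : I^N) ∈ Cube.boundary N := ⟨Classical.arbitrary N, Or.inl rfl⟩
  have hux : hopf u = x := by
    have h1 := hu 0
    have h2 : ψ 0 = 1 := ψ.2 0 hz0
    rw [h2, mul_one] at h1
    exact h1.symm.trans (f.2 0 hz0)
  have hvx : hopf v = x := by
    have h1 := hv 0
    have h2 : χ 0 = 1 := χ.2 0 hz0
    rw [h2, mul_one] at h1
    exact h1.symm.trans (g.2 0 hz0)
  obtain ⟨c, hc⟩ := exists_eq_mul_ofCircle (ContinuousMap.const Unit u) (ContinuousMap.const Unit v)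
    fun _ => hux.trans hvx.symm
  replace hc : v = u * ofCircle (c ()) := hc ()
  have hχc : Continuous χ := χ.1.continuous
  let χ' : Ω^ N UnitQuaternion 1 :=
    ⟨⟨fun z => ofCircle (c ()) * χ z * (ofCircle (c ()))⁻¹, by fun_prop⟩, fun z hz => by
      have h1 : χ z = 1 := χ.2 z hz
      change ofCircle (c ()) * χ z * (ofCircle (c ()))⁻¹ = 1
      rw [h1, mul_one, mul_inv_cancel]⟩
  obtain ⟨K⟩ : GenLoop.Homotopic ψ χ' :=
    hψ.trans (hχ.symm.trans (homotopic_conj (ofCircle (c ())) (fun _ => rfl)).symm)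
  refine ⟨⟨⟨⟨fun p => hopf (u * K p), by fun_prop⟩, fun z => ?_, fun z => ?_⟩, ?_⟩⟩
  · change hopf (u * K (0, z)) = f z
    rw [K.apply_zero, hu]
    rfl
  · change hopf (u * K (1, z)) = g z
    rw [K.apply_one, hv, hc, ← hopf_mul_ofCircle _ (c ())]
    change hopf (u * (ofCircle (c ()) * χ z * (ofCircle (c ()))⁻¹) * ofCircle (c ())) = _
    congr 1
    group
  · intro r z hz
    change hopf (u * K (r, z)) = f z
    rw [K.eq_fst r hz, hu]
    rfl

/-- The antipodal map preserves the class, which it changes to a conjugate. -/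
theorem HasHopfClass.antipode {f : Ω^ N TwoSphere x} {φ : Ω^ N UnitQuaternion 1}
    (h : HasHopfClass f φ) : HasHopfClass (genLoopMap antipode f) φ := by
  obtain ⟨u, ψ, hu, hψ⟩ := h
  have hψc : Continuous ψ := ψ.1.continuous
  refine ⟨u * quatJ, ⟨⟨fun z => quatJ⁻¹ * ψ z * quatJ, by fun_prop⟩, fun z hz => by
      have h1 : ψ z = 1 := ψ.2 z hz
      change quatJ⁻¹ * ψ z * quatJ = 1
      rw [h1, mul_one, inv_mul_cancel]⟩, fun z => ?_,
    .trans (homotopic_conj quatJ⁻¹ fun z => ?_) hψ⟩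
  · change -f z = hopf (u * quatJ * (quatJ⁻¹ * ψ z * quatJ))
    rw [hu, ← hopf_mul_quatJ]
    congr 1
    group
  · change quatJ⁻¹ * ψ z * quatJ = quatJ⁻¹ * ψ z * quatJ⁻¹⁻¹
    rw [inv_inv]

end TwoSphere

/-! ### Configurations of points -/

section Pair

variable {X Z : Type*} [TopologicalSpace X] [TopologicalSpace Z]

/-- The configuration of two distinct points. -/
def configurationPair (a b : X) (h : a ≠ b) : ConfigurationSpace 2 X :=
  ⟨![a, b], by simp [Fin.forall_fin_two, h, h.symm]⟩

theorem eq_configurationPair {w : ConfigurationSpace 2 X} {a b : X} (h : a ≠ b) (ha : w.1 0 = a)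
    (hb : w.1 1 = b) : w = configurationPair a b h := by
  refine Subtype.ext (funext fun i => ?_)
  fin_cases i
  exacts [ha, hb]

theorem continuous_configurationPair {f g : Z → X} (hf : Continuous f) (hg : Continuous g)
    (h : ∀ z, f z ≠ g z) : Continuous fun z => configurationPair (f z) (g z) (h z) :=
  Continuous.subtype_mk (continuous_pi fun i => by
    fin_cases i
    exacts [hf, hg]) _

end Pair

namespace TwoSphere

open HomotopyGroup

/-- The segment from `y` to `-x` does not meet the ray through `x`. -/
theorem segment_ne_smul {x y : TwoSphere} (h : x ≠ y) (t : I) {c : ℝ} (hc : 0 ≤ c) :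
    (1 - t : ℝ) • y.1 - (t : ℝ) • x.1 ≠ c • x.1 := by
  intro h0
  have h1 : (1 - t : ℝ) • y.1 = (c + t) • x.1 := by rw [add_smul]; exact sub_eq_iff_eq_add.1 h0
  have h2 := congrArg norm h1
  rw [norm_smul, norm_smul, mem_sphere_zero_iff_norm.1 x.2, mem_sphere_zero_iff_norm.1 y.2,
    Real.norm_of_nonneg (by linarith [t.2.2]), Real.norm_of_nonneg (by linarith [t.2.1]), mul_one,
    mul_one] at h2
  rw [← h2] at h1
  have h3 : (1 - t : ℝ) ≠ 0 := fun h3 => by linarith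
  exact h (Subtype.ext (smul_right_injective _ h3 h1)).symm

/-- The map `x ↦ (x, -x)` to the configuration space of two points. -/
def antipodalPair : C(TwoSphere, ConfigurationSpace 2 TwoSphere) :=
  ⟨fun x => configurationPair x (-x) (ne_neg_self x),
    continuous_configurationPair continuous_id continuous_neg _⟩

/-- The first point of a configuration of two points. -/
def firstPoint : C(ConfigurationSpace 2 TwoSphere, TwoSphere) :=
  (proj 0).comp (configurationInclusion 2 TwoSphere)

/-- The second point of a configuration of two points. -/
def secondPoint : C(ConfigurationSpace 2 TwoSphere, TwoSphere) :=
  (proj 1).comp (configurationInclusion 2 TwoSphere)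

/-- The deformation of the configuration space of two points which fixes the first point and moves
the second one to the antipode of the first one. -/
theorem exists_deformation : ∃ D : C(I × ConfigurationSpace 2 TwoSphere,
      ConfigurationSpace 2 TwoSphere), (∀ w, D (0, w) = w) ∧
    (∀ w, D (1, w) = antipodalPair (firstPoint w)) ∧
    ∀ t w, firstPoint (D (t, w)) = firstPoint w := by
  let A : C(I × ConfigurationSpace 2 TwoSphere, EuclideanSpace ℝ (Fin 3)) :=
    ⟨fun p => (1 - p.1 : ℝ) • (secondPoint p.2).1 - (p.1 : ℝ) • (firstPoint p.2).1, by fun_prop⟩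
  have hne : ∀ w : ConfigurationSpace 2 TwoSphere, firstPoint w ≠ secondPoint w := fun w =>
    w.2 0 1 zero_ne_one
  have hA : ∀ p, A p ≠ 0 := fun p h =>
    segment_ne_smul (hne p.2) p.1 le_rfl (h.trans (zero_smul _ _).symm)
  have hA' : ∀ p, firstPoint p.2 ≠ normalizeMap A hA p := fun p h => by
    have hp : A p = ‖A p‖ • (normalizeMap A hA p).1 := by
      change A p = ‖A p‖ • ‖A p‖⁻¹ • A p
      rw [smul_inv_smul₀ (norm_ne_zero_iff.2 (hA p))]
    rw [← h] at hp
    exact segment_ne_smul (hne p.2) p.1 (norm_nonneg (A p)) hp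
  refine ⟨⟨fun p => configurationPair (firstPoint p.2) (normalizeMap A hA p) (hA' p),
    continuous_configurationPair (by fun_prop) (by fun_prop) _⟩, fun w => ?_, fun w => ?_,
    fun t w => rfl⟩
  · exact (eq_configurationPair (hA' (0, w)) rfl
      (normalizeMap_eq (u := secondPoint w) hA (by simp [A])).symm).symm
  · exact eq_configurationPair (ne_neg_self _) rfl
      (normalizeMap_eq (u := -firstPoint w) hA (by simp [A]))

section

variable {N : Type*}

theorem exists_homotopicAlong_antipodalPair (w : ConfigurationSpace 2 TwoSphere) :
    ∃ γ : Path w (antipodalPair (firstPoint w)), (∀ t, firstPoint (γ t) = firstPoint w) ∧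
      ∀ p : Ω^ N (ConfigurationSpace 2 TwoSphere) w,
        HomotopicAlong γ p (genLoopMap antipodalPair (genLoopMap firstPoint p)) := by
  obtain ⟨D, D0, D1, Df⟩ := exists_deformation
  refine ⟨⟨⟨fun t => D (t, w), by fun_prop⟩, D0 w, D1 w⟩, fun t => Df t w, fun p => ?_⟩
  refine ⟨⟨fun q => D (q.1, p.1 q.2), by fun_prop⟩, fun z => D0 _, fun z => D1 _, fun t z hz => ?_⟩
  exact congrArg (fun v => D (t, v)) (p.2 z hz)

/-- If two loops have different values everywhere, then the second one is freely homotopic to the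
antipode of the first one. -/
theorem exists_homotopicAlong_antipode [Fintype N] [Nonempty N] {x y : TwoSphere} (hxy : x ≠ y)
    (f : Ω^ N TwoSphere x) (g : Ω^ N TwoSphere y) (h : ∀ z, f z ≠ g z) :
    ∃ γ : Path (-x) y, HomotopicAlong γ (genLoopMap antipode f) g := by
  let p : Ω^ N (ConfigurationSpace 2 TwoSphere) (configurationPair x y hxy) :=
    ⟨⟨fun z => configurationPair (f z) (g z) (h z),
      continuous_configurationPair f.1.continuous g.1.continuous h⟩,
      fun z hz => eq_configurationPair _ (f.2 z hz) (g.2 z hz)⟩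
  obtain ⟨γ, -, hγ⟩ := exists_homotopicAlong_antipodalPair (N := N) (configurationPair x y hxy)
  exact ⟨_, ((hγ p).map secondPoint).symm⟩

end

/-- The first point induces an isomorphism of homotopy groups, since the configuration space of two
points deforms to the space of antipodal pairs. -/
theorem map_firstPoint_bijective {N : Type*} [Fintype N] [Nonempty N] [DecidableEq N]
    (w : ConfigurationSpace 2 TwoSphere) : Function.Bijective (map (N := N) firstPoint w) := by
  obtain ⟨γ, hγ1, hγ⟩ := exists_homotopicAlong_antipodalPair (N := N) w
  constructor
  · rw [injective_iff_map_eq_one]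
    rintro ⟨p⟩ h
    have h1 : transport γ (mk p) = map antipodalPair _ (map firstPoint w (mk p)) :=
      mk_eq_mk (hγ p).transport_homotopic
    have h' : map firstPoint w (mk p) = 1 := h
    rw [h', map_one] at h1
    exact (map_eq_one_iff _ (transport γ).injective).1 h1
  · rintro ⟨f⟩
    refine ⟨mk (genLoopTransport γ.symm (genLoopMap antipodalPair f)), ?_⟩
    have h := (homotopicAlong_transport γ.symm (genLoopMap antipodalPair f)).map firstPoint
    exact (mk_eq_mk (HomotopicAlong.homotopic_of_const (x := firstPoint w)
      (γ := γ.symm.map firstPoint.continuous) h fun t => hγ1 (σ t))).symm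

end TwoSphere

section Components

open HomotopyGroup

variable {n k : ℕ} [NeZero k] {X : Type*} [TopologicalSpace X] {w : ConfigurationSpace n X} {x₀ : X}

/-- The `i`-th component of a loop in a configuration space. -/
def configurationComponent (i : Fin n) (p : Ω^ (Fin k) (ConfigurationSpace n X) w) :
    Ω^ (Fin k) X (configurationInclusion n X w i) :=
  genLoopMap (proj i) (genLoopMap (configurationInclusion n X) p)

theorem iotaHom_mk (γ : ∀ i, Path (configurationInclusion n X w i) x₀)
    (p : Ω^ (Fin k) (ConfigurationSpace n X) w) (i : Fin n) :
    iotaHom k w γ (mk p) i = mk (genLoopTransport (γ i) (configurationComponent i p)) := rfl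

end Components

namespace TwoSphere

open HomotopyGroup

theorem exists_homotopicAlong_component {n k : ℕ} [NeZero k] {w : ConfigurationSpace n TwoSphere}
    (p : Ω^ (Fin k) (ConfigurationSpace n TwoSphere) w) {i j : Fin n} (hij : i ≠ j) :
    ∃ γ, HomotopicAlong γ (genLoopMap antipode (configurationComponent i p))
      (configurationComponent j p) :=
  exists_homotopicAlong_antipode (w.2 i j hij) _ _ fun z => (p.1 z).2 i j hij

/-- Two components of a loop of configurations have the same Hopf class, since one is freely
homotopic to the antipode of the other. -/
theorem iotaHom_isDiagonalHom {n k : ℕ} [NeZero k] (hk : 3 ≤ k) (w : ConfigurationSpace n TwoSphere)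
    {x₀ : TwoSphere} (γ : ∀ i, Path (configurationInclusion n TwoSphere w i) x₀) :
    IsDiagonalHom (iotaHom k w γ) := by
  rintro ⟨p⟩ i j
  by_cases hij : i = j
  · rw [hij]
  obtain ⟨m, rfl⟩ : ∃ m, k = m + 1 := ⟨k - 1, by omega⟩
  obtain ⟨φ, hφ⟩ := exists_hasHopfClass (by omega) (configurationComponent i p)
  obtain ⟨_, hδ⟩ := exists_homotopicAlong_component p hij
  exact mk_eq_mk ((hφ.of_homotopicAlong (homotopicAlong_transport (γ i) _)).homotopic
    ((hφ.antipode.of_homotopicAlong hδ).of_homotopicAlong (homotopicAlong_transport (γ j) _)))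

/-- The two components of a loop of configurations have opposite degrees. -/
theorem iotaHom_isAntiDiagonalHom (w : ConfigurationSpace 2 TwoSphere)
    {x₀ : TwoSphere} (γ : ∀ i, Path (configurationInclusion 2 TwoSphere w i) x₀) :
    IsAntiDiagonalHom (iotaHom 2 w γ) := by
  rintro ⟨p⟩
  obtain ⟨d, hd⟩ := exists_hasDegree (configurationComponent 0 p)
  obtain ⟨_, hδ⟩ := exists_homotopicAlong_component p (zero_ne_one (α := Fin 2))
  apply (degree_bijective x₀).injective
  rw [map_inv]
  change degree x₀ (iotaHom 2 w γ (mk p) 1) = (degree x₀ (iotaHom 2 w γ (mk p) 0))⁻¹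
  rw [iotaHom_mk, iotaHom_mk, degree_mk (hd.of_homotopicAlong (homotopicAlong_transport (γ 0) _)),
    degree_mk ((hd.antipode.of_homotopicAlong hδ).of_homotopicAlong
      (homotopicAlong_transport (γ 1) _)), ofAdd_neg]

theorem iotaHom_zero_bijective {k : ℕ} [NeZero k] (w : ConfigurationSpace 2 TwoSphere)
    {x₀ : TwoSphere} (γ : ∀ i, Path (configurationInclusion 2 TwoSphere w i) x₀) :
    Function.Bijective ((Pi.evalMonoidHom _ (0 : Fin 2)).comp (iotaHom k w γ)) := by
  have h : ⇑((Pi.evalMonoidHom _ (0 : Fin 2)).comp (iotaHom k w γ)) =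
      transport (γ 0) ∘ map firstPoint w := by
    funext a
    obtain ⟨p⟩ := a
    rfl
  rw [h]
  exact (transport (γ 0)).bijective.comp (map_firstPoint_bijective w)

end TwoSphere

theorem Multiplicative.toAdd_eq_one_or_of_zpowers_eq_top {a : Multiplicative ℤ}
    (h : Subgroup.zpowers a = ⊤) : a.toAdd = 1 ∨ a.toAdd = -1 := by
  obtain ⟨m, hm⟩ := Subgroup.mem_zpowers_iff.1 (h ▸ Subgroup.mem_top (Multiplicative.ofAdd (1 : ℤ)))
  have h1 : m * a.toAdd = 1 := by simpa using congrArg Multiplicative.toAdd hm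
  exact Int.isUnit_iff.1 (IsUnit.of_mul_eq_one_right m h1)

end

theorem proposition4 :
    (∀ (w : ConfigurationSpace 2 TwoSphere) (x₀ : TwoSphere)
      (γ : ∀ i, Path (configurationInclusion 2 TwoSphere w i) x₀),
      Nonempty (π_ 2 (ConfigurationSpace 2 TwoSphere) w ≃* Multiplicative ℤ) ∧
      Nonempty (π_ 2 TwoSphere x₀ ≃* Multiplicative ℤ) ∧
      IsAntiDiagonalHom (iotaHom 2 w γ) ∧
      ∀ (φ : π_ 2 TwoSphere x₀ ≃* Multiplicative ℤ)
        (g : π_ 2 (ConfigurationSpace 2 TwoSphere) w), Subgroup.zpowers g = ⊤ →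
        (fun i => (φ (iotaHom 2 w γ g i)).toAdd) = ![1, -1] ∨
        (fun i => (φ (iotaHom 2 w γ g i)).toAdd) = ![-1, 1]) ∧
    (∀ (n k : ℕ) [NeZero k], 2 ≤ n → 3 ≤ k →
      ∀ (w : ConfigurationSpace n TwoSphere) (x₀ : TwoSphere)
        (γ : ∀ i, Path (configurationInclusion n TwoSphere w i) x₀),
        IsDiagonalHom (iotaHom k w γ)) := by
  refine ⟨fun w x₀ γ => ?_, fun n k _ _ hk w x₀ γ => TwoSphere.iotaHom_isDiagonalHom hk w γ⟩
  let c := MulEquiv.ofBijective _ (TwoSphere.iotaHom_zero_bijective (k := 2) w γ)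
  let e := MulEquiv.ofBijective _ (TwoSphere.degree_bijective x₀)
  have hanti := TwoSphere.iotaHom_isAntiDiagonalHom w γ
  refine ⟨⟨c.trans e⟩, ⟨e⟩, hanti, fun φ g hg => ?_⟩
  have htop : Subgroup.zpowers (φ (iotaHom 2 w γ g 0)) = ⊤ := by
    have h := congrArg (Subgroup.map (c.trans φ).toMonoidHom) hg
    rw [MonoidHom.map_zpowers, Subgroup.map_top_of_surjective _ (c.trans φ).surjective] at h
    exact h
  have h1 : (φ (iotaHom 2 w γ g 1)).toAdd = -(φ (iotaHom 2 w γ g 0)).toAdd := by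
    rw [hanti, map_inv, toAdd_inv]
  refine (Multiplicative.toAdd_eq_one_or_of_zpowers_eq_top htop).imp (fun h => ?_) fun h => ?_
  all_goals
    funext i
    fin_cases i
  exacts [h, h1.trans (by rw [h]; rfl), h, h1.trans (by rw [h]; rfl)]
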